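/- Let $d\ge 1$ and let $\mathbf X=(X_t)_{t\ge 0}$ be an isotropic unimodal pure jump Lévy process in $\mathbb R^d$ with $X_0=0$ almost surely. That is, for every $t>0$ the law of $X_t$ is absolutely continuous on $\mathbb R^d\setminus\{0\}$ with a radial and radially non-increasing density, and $$\mathbb E e^{i\langle \xi,X_t\rangle}=e^{-t\psi(\xi)},\qquad \psi(\xi)=\int_{\mathbb R^d}\bigl(1-\cos\langle\xi,x\rangle\bigr)\,\nu(\mathrm dx),$$ where $\nu$ is a Lévy measure, i.e. $\nu(\{0\})=0$ and $\int\min(1,|x|^2)\,\nu(\mathrm dx)<\infty$. Write $\psi(r)=\psi(\xi)$ for $|\xi|=r$. Suppose that $\mathbf X$ is transient, i.e. its potential measure $G(A)=\int_0^\infty\mathbb P(X_t\in A)\,\mathrm dt$ is finite on compact sets. Then on $\mathbb R^d\setminus\{0\}$ the measure $G$ has a radial and radially non-increasing (finite) density with respect to Lebesgue measure, and every such density, denoted $G(x)$, satisfies the following. (a) Let $\ell$ be slowly varying at infinity: $\ell\ge 0$ near infinity and $\lim_{x\to\infty}\ell(\lambda x)/\ell(x)=1$ for every $\lambda>0$.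 If $\psi\in\Pi_\ell^\infty$, that is, $\lim_{x\to\infty}\frac{\psi(\lambda x)-\psi(x)}{\ell(x)}=\log\lambda$ for every $\lambda>0$, then $$\lim_{x\to 0}\frac{G(x)}{|x|^{-d}\,\psi(|x|^{-1})^{-2}\,\ell(|x|^{-1})}=\frac{\Gamma(d/2)}{2\pi^{d/2}}.$$ (b) Let $\ell$ be slowly varying at zero: $\ell>0$ on a right neighbourhood of $0$ and $x\mapsto\ell(x^{-1})$ is slowly varying at infinity. If $\psi\in\Pi_\ell^0$, that is, $\psi>0$ on a right neighbourhood of $0$ and $\lim_{x\to 0^+}\frac{\psi(\lambda x)-\psi(x)}{\ell(x)}=\log\lambda$ for every $\lambda>0$, then $$\lim_{|x|\to\infty}\frac{G(x)}{|x|^{-d}\,\psi(|x|^{-1})^{-2}\,\ell(|x|^{-1})}=\frac{\Gamma(d/2)}{2\pi^{d/2}}.$$ -/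

import Mathlib

open MeasureTheory ProbabilityTheory Filter Topology
open scoped NNReal ENNReal RealInnerProductSpace

/-- `ℓ` is slowly varying at infinity (class `R_0^∞`). The function only matters near infinity:
this is the notion for functions `[a, ∞) → [0, ∞)`, extended arbitrarily to `ℝ`. -/
def SlowlyVaryingAtInfty (l : ℝ → ℝ) : Prop :=
  (∀ᶠ x in atTop, 0 ≤ l x) ∧
    ∀ c : ℝ, 0 < c → Tendsto (fun x => l (c * x) / l x) atTop (𝓝 1)

/-- `ℓ` is slowly varying at zero (class `R_0^0`): it is positive on a right neighbourhood of zero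
and `x ↦ ℓ (x⁻¹)` is slowly varying at infinity. -/
def SlowlyVaryingAtZero (l : ℝ → ℝ) : Prop :=
  (∀ᶠ x in 𝓝[>] (0 : ℝ), 0 < l x) ∧ SlowlyVaryingAtInfty (fun x => l x⁻¹)

/-- The de Haan class `Π_ℓ^∞` at infinity determined by `ℓ`. -/
def deHaanAtInfty (l : ℝ → ℝ) : Set (ℝ → ℝ) :=
  {f | (∀ᶠ x in atTop, 0 ≤ f x) ∧
    ∀ c : ℝ, 0 < c → Tendsto (fun x => (f (c * x) - f x) / l x) atTop (𝓝 (Real.log c))}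

/-- The de Haan class `Π_ℓ^0` at the origin determined by `ℓ`. -/
def deHaanAtZero (l : ℝ → ℝ) : Set (ℝ → ℝ) :=
  {f | (∀ᶠ x in 𝓝[>] (0 : ℝ), 0 < f x) ∧
    ∀ c : ℝ, 0 < c → Tendsto (fun x => (f (c * x) - f x) / l x) (𝓝[>] 0) (𝓝 (Real.log c))}

section

variable {E : Type*} [NormedAddCommGroup E] [InnerProductSpace ℝ E] [MeasurableSpace E]

/-- A Lévy measure: no mass at the origin and `∫ min (1, |x|²) ν(dx) < ∞`. -/
def IsLevyMeasure (ν : Measure E) : Prop :=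
  ν {0} = 0 ∧ ∫⁻ x, ENNReal.ofReal (min 1 (‖x‖ ^ 2)) ∂ν < ∞

/-- The exponent `ψ(ξ) = ∫ (1 - cos ⟨ξ, x⟩) ν(dx)`. The integrand is `ν`-integrable when `ν` is a
Lévy measure. -/
noncomputable def levyExponent (ν : Measure E) (ξ : E) : ℝ :=
  ∫ x, (1 - Real.cos ⟪ξ, x⟫) ∂ν

end

section

variable {d : ℕ} {Ω : Type*} [MeasurableSpace Ω]

/-- `g` is a radial, radially non-increasing Lebesgue density, on the complement of the origin, of
the set function (in practice a Borel measure) `m`. Nothing is said about an atom of `m` at the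
origin or about the value `g 0`. -/
def IsUnimodalDensity (m : Set (EuclideanSpace ℝ (Fin d)) → ℝ≥0∞)
    (g : EuclideanSpace ℝ (Fin d) → ℝ≥0) : Prop :=
  (∀ x y : EuclideanSpace ℝ (Fin d), x ≠ 0 → ‖x‖ ≤ ‖y‖ → g y ≤ g x) ∧
    ∀ A : Set (EuclideanSpace ℝ (Fin d)), MeasurableSet A → 0 ∉ A →
      m A = ∫⁻ x in A, (g x : ℝ≥0∞)

/-- `X` is a Lévy process in `ℝ^d` under `P`, started at the origin. -/
structure IsLevyProcess (X : ℝ≥0 → Ω → EuclideanSpace ℝ (Fin d)) (P : Measure Ω) : Prop where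
  measurable : ∀ t, Measurable (X t)
  zero : ∀ᵐ ω ∂P, X 0 ω = 0
  indep : HasIndepIncrements X P
  stationary : ∀ s t : ℝ≥0, IdentDistrib (fun ω => X (s + t) ω - X s ω) (X t) P P
  cadlag : ∀ᵐ ω ∂P, ∀ t : ℝ≥0,
    ContinuousWithinAt (fun s => X s ω) (Set.Ici t) t ∧
      ∃ y, Tendsto (fun s => X s ω) (𝓝[<] t) (𝓝 y)

/-- `X` is an isotropic unimodal pure jump Lévy process with Lévy measure `ν`: every law of `X t`,
`t > 0`, has a radial and radially non-increasing density off the origin, and there is no Gaussian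
part, i.e. `𝔼 exp (i ⟨ξ, X t⟩) = exp (- t ψ(ξ))` with `ψ` the exponent determined by `ν`. -/
structure IsIsotropicUnimodalLevyProcess (X : ℝ≥0 → Ω → EuclideanSpace ℝ (Fin d)) (P : Measure Ω)
    (ν : Measure (EuclideanSpace ℝ (Fin d))) : Prop extends IsLevyProcess X P where
  unimodal : ∀ t : ℝ≥0, 0 < t →
    ∃ p : EuclideanSpace ℝ (Fin d) → ℝ≥0, IsUnimodalDensity (fun A => P.map (X t) A) p
  levyMeasure : IsLevyMeasure ν
  charFun_eq : ∀ (t : ℝ≥0) (ξ : EuclideanSpace ℝ (Fin d)),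
    charFun (P.map (X t)) ξ = Complex.exp (((-(t * levyExponent ν ξ) : ℝ)) : ℂ)

/-- The potential measure `G(A) = ∫_0^∞ P(X_t ∈ A) dt` of a process started at the origin. -/
noncomputable def potentialMeasure (X : ℝ≥0 → Ω → EuclideanSpace ℝ (Fin d)) (P : Measure Ω)
    (A : Set (EuclideanSpace ℝ (Fin d))) : ℝ≥0∞ :=
  ∫⁻ t in Set.Ioi (0 : ℝ), P (X t.toNNReal ⁻¹' A)

/-- Transience: the potential measure is finite on compact sets. -/
def IsTransient (X : ℝ≥0 → Ω → EuclideanSpace ℝ (Fin d)) (P : Measure Ω) : Prop :=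
  ∀ K : Set (EuclideanSpace ℝ (Fin d)), IsCompact K → potentialMeasure X P K < ∞

/-- For a radial function `f` on `ℝ^d`, the function `r ↦ f(r)` on the half-line. -/
noncomputable def radialProfile [NeZero d] (f : EuclideanSpace ℝ (Fin d) → ℝ) (r : ℝ) : ℝ :=
  f (EuclideanSpace.single (0 : Fin d) r)

end

/-! The link between `G` and `ψ` is a Gaussian average. Integrating `exp (-s²|x|²/2)` against the
law of `X t` and using the Fourier transform of the Gaussian gives a Gaussian average of `exp (-t
ψ(sξ))`; integrating over `t` turns this into a Gaussian average of `1 / ψ(sξ)`. In polar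
coordinates, with `φ` the radial profile of `G`, the transform of `φ(y) y^(d-1)` by the profile
`g(y) = exp (-y²/2)`, plus a possible atom at the origin, equals an average of `1 / ψ(rs)` over `r`.
This is `GaussianPotentialIdentity`.

The de Haan condition speaks of increments, so the identity at `s` and at `bs` is subtracted, which
also removes the atom. The increment `1/ψ(x) - 1/ψ(bx)` is equivalent to `log b * l(x) / ψ(x)²`,
hence slowly varying, and the Abelian theorem `tendsto_integral_gaussWeight_div` (dominated
convergence under Potter's bound) replaces its Gaussian average by its value at `s`, up to a
constant.

There remains a Tauberian step, `tendsto_apply_one_of_tendsto_integral`. The rescaled profiles `φ_s`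
satisfy `∫ (g(y) - g(by)) φ_s(y) y^(d-1) dy → K log b`, and Frullani's integral identifies the limit
as that of the density `K / y`. Powers of `g` are dilates of `g`, so these limits are moments in the
variable `g(y)`; Weierstrass approximation extends them to bumps on either side of `y = 1`, and
monotonicity of `φ_s` yields `φ_s(1) → K`. The constant is the reciprocal of the area of the unit
sphere.

Existence of the unimodal density of `G` is a separate matter: a mixture of unimodal laws is
unimodal, once the densities are chosen jointly measurable in time and space. -/

/-! ### Uniform bounds for slowly varying functions -/

/-- If the increments `k (t + u) - k t` of a continuous function tend to zero for every `u ≥ 0`,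
then they are bounded uniformly for small `u`. -/
theorem exists_increment_le_two {k : ℝ → ℝ} {T : ℝ} (hk : ContinuousOn k (Set.Ici T))
    (h : ∀ u, 0 ≤ u → Tendsto (fun t => k (t + u) - k t) atTop (𝓝 0)) :
    ∃ δ > 0, ∃ T', ∀ t ≥ T', ∀ u, 0 ≤ u → u ≤ δ → |k (t + u) - k t| ≤ 2 := by
  -- Baire category: these sets are closed and cover the line, so one of them contains an interval.
  -- Using `|u|` lets the argument take place on all of `ℝ`.
  let E : ℕ → Set ℝ := fun n => {u | ∀ t, max T n ≤ t → |k (t + |u|) - k t| ≤ 1}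
  have hcl : ∀ n, IsClosed (E n) := by
    intro n
    have : E n = ⋂ t, ⋂ (_ : max T n ≤ t), {u | |k (t + |u|) - k t| ≤ 1} := by
      ext u; simp [E]
    rw [this]
    refine isClosed_iInter fun t => isClosed_iInter fun ht => ?_
    refine isClosed_le (Continuous.abs (Continuous.sub ?_ continuous_const)) continuous_const
    refine hk.comp_continuous (by fun_prop) fun u => ?_
    have := le_trans (le_max_left T n) ht
    have := abs_nonneg u
    simp only [Set.mem_Ici]; linarith
  have hun : ⋃ n, E n = Set.univ := by
    refine Set.eq_univ_of_forall fun u => ?_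
    have h1 := (h |u| (abs_nonneg u)).eventually (Metric.closedBall_mem_nhds 0 one_pos)
    obtain ⟨N, hN⟩ := eventually_atTop.1 h1
    obtain ⟨n, hn⟩ := exists_nat_ge N
    refine Set.mem_iUnion.2 ⟨n, fun t ht => ?_⟩
    have := hN t (hn.trans ((le_max_right _ _).trans ht))
    simpa [Real.dist_eq] using this
  obtain ⟨n, x, hx⟩ := nonempty_interior_of_iUnion_of_closed hcl hun
  obtain ⟨δ, hδ, hball⟩ := Metric.isOpen_iff.1 isOpen_interior x hx
  have hsub := hball.trans interior_subset
  -- Moving away from the origin, from `x` to `x + v` or `x - v` according to the sign of `x`, stays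
  -- in the interval and makes the absolute value `|x| + v`. Comparing `v = u` with `v = 0` from the
  -- base point `t - |x|` then costs at most `1 + 1`.
  have key : ∀ v, 0 ≤ v → v ≤ δ / 2 → ∀ t, max T n ≤ t → |k (t + (|x| + v)) - k t| ≤ 1 := by
    intro v hv hv' t ht
    rcases le_total 0 x with hx0 | hx0
    · have hm : x + v ∈ E n := hsub (by
        simp only [Metric.mem_ball, Real.dist_eq, add_sub_cancel_left, abs_of_nonneg hv]; linarith)
      have := hm t ht
      rwa [abs_of_nonneg (by linarith : 0 ≤ x + v), ← abs_of_nonneg hx0] at this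
    · have hm : x - v ∈ E n := hsub (by
        simp only [Metric.mem_ball, Real.dist_eq, sub_sub_cancel_left, abs_neg, abs_of_nonneg hv]
        linarith)
      have := hm t ht
      rw [abs_of_nonpos (by linarith : x - v ≤ 0)] at this
      rw [abs_of_nonpos hx0]
      convert this using 5; ring
  refine ⟨δ / 2, by linarith, max T n + |x|, fun t ht u hu hu' => ?_⟩
  have h1 := key u hu hu' (t - |x|) (by linarith)
  have h2 := key 0 le_rfl (by linarith) (t - |x|) (by linarith)
  rw [show t - |x| + (|x| + u) = t + u by ring] at h1
  rw [show t - |x| + (|x| + 0) = t by ring] at h2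
  rw [abs_le] at *
  constructor <;> linarith [h1.1, h1.2, h2.1, h2.2]

theorem exists_increment_le_of_le_one {k : ℝ → ℝ} {T : ℝ} (hk : ContinuousOn k (Set.Ici T))
    (h : ∀ u, 0 ≤ u → Tendsto (fun t => k (t + u) - k t) atTop (𝓝 0)) :
    ∃ C T', ∀ t ≥ T', ∀ u, 0 ≤ u → u ≤ 1 → |k (t + u) - k t| ≤ C := by
  obtain ⟨δ, hδ, T', hT'⟩ := exists_increment_le_two hk h
  obtain ⟨m, hm⟩ := exists_nat_ge (1 / δ)
  have hm0 : (0 : ℝ) < m := lt_of_lt_of_le (by positivity) hm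
  refine ⟨2 * m, T', fun t ht u hu hu1 => ?_⟩
  have hv : u / m ≤ δ := by
    rw [div_le_iff₀ hm0]
    rw [div_le_iff₀ hδ] at hm
    linarith
  have hv0 : 0 ≤ u / m := by positivity
  have ind : ∀ j : ℕ, |k (t + j * (u / m)) - k t| ≤ 2 * j := by
    intro j
    induction j with
    | zero => simp
    | succ j ih =>
      have h1 := hT' (t + j * (u / m)) (by have : 0 ≤ j * (u / m) := by positivity
                                           linarith) (u / m) hv0 hv
      rw [show t + j * (u / m) + u / m = t + ((j + 1 : ℕ) : ℝ) * (u / m) by push_cast; ring] at h1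
      push_cast at *
      rw [abs_le] at *
      constructor <;> linarith [h1.1, h1.2, ih.1, ih.2]
  have := ind m
  rwa [mul_div_cancel₀ _ hm0.ne'] at this

/-- Each of the `⌊u⌋₊` unit steps costs at most `ε`; the fractional remainder is absorbed in `C`. -/
theorem exists_increment_le_linear {k : ℝ → ℝ} {T ε : ℝ} (hk : ContinuousOn k (Set.Ici T))
    (h : ∀ u, 0 ≤ u → Tendsto (fun t => k (t + u) - k t) atTop (𝓝 0)) (hε : 0 < ε) :
    ∃ C T', ∀ t ≥ T', ∀ u, 0 ≤ u → |k (t + u) - k t| ≤ ε * u + C := by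
  obtain ⟨C, T₁, h₁⟩ := exists_increment_le_of_le_one hk h
  obtain ⟨T₂, h₂⟩ := eventually_atTop.1
    ((h 1 zero_le_one).eventually (Metric.closedBall_mem_nhds 0 hε))
  simp only [Real.dist_eq, sub_zero] at h₂
  refine ⟨C, max T₁ T₂, fun t ht u hu => ?_⟩
  have ht1 := (le_max_left _ _).trans ht
  have ht2 := (le_max_right _ _).trans ht
  have ind : ∀ j : ℕ, |k (t + j) - k t| ≤ ε * j := by
    intro j
    induction j with
    | zero => simp
    | succ j ih =>
      have h3 := h₂ (t + j) (by have : (0 : ℝ) ≤ j := by positivity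
                                linarith)
      rw [add_assoc] at h3
      push_cast
      rw [abs_le] at *
      constructor <;> linarith [h3.1, h3.2, ih.1, ih.2]
  have hfl := Nat.floor_le hu
  have hlt := Nat.lt_floor_add_one u
  have h4 := ind ⌊u⌋₊
  have h5 := h₁ (t + ⌊u⌋₊) (by have : (0 : ℝ) ≤ ⌊u⌋₊ := by positivity
                               linarith) (u - ⌊u⌋₊) (by linarith) (by linarith)
  rw [show t + ⌊u⌋₊ + (u - ⌊u⌋₊) = t + u by ring] at h5
  have h6 := mul_le_mul_of_nonneg_left hfl hε.le
  rw [abs_le] at *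
  constructor <;> linarith [h4.1, h4.2, h5.1, h5.2]

/-- `D` is positive on `U` and satisfies Potter's bound there with exponent `1/2`. -/
def PotterOn (D : ℝ → ℝ) (U : Set ℝ) (C : ℝ) : Prop :=
  ∀ x ∈ U, 0 < D x ∧ ∀ r, 0 < r → r * x ∈ U →
    D (r * x) ≤ C * (r ^ (1 / 2 : ℝ) + r ^ (-(1 / 2) : ℝ)) * D x

/-- **Potter's bound** for continuous slowly varying functions. -/
theorem exists_potterOn_Ici {D : ℝ → ℝ} {X : ℝ} (hD : ContinuousOn D (Set.Ici X))
    (hpos : ∀ x ≥ X, 0 < D x)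
    (h : ∀ c : ℝ, 0 < c → Tendsto (fun x => D (c * x) / D x) atTop (𝓝 1)) :
    ∃ C > 0, ∃ X' > 0, PotterOn D (Set.Ici X') C := by
  have hev : ∀ᶠ t in atTop, X ≤ Real.exp t := Real.tendsto_exp_atTop.eventually_ge_atTop X
  obtain ⟨T, hT⟩ := eventually_atTop.1 hev
  -- In logarithmic coordinates slow variation says that increments vanish, and the linear bound
  -- with slope `1/2` exponentiates to Potter's bound.
  let k : ℝ → ℝ := fun t => Real.log (D (Real.exp t))
  have hk : ContinuousOn k (Set.Ici T) := by
    refine ContinuousOn.log (hD.comp Real.continuous_exp.continuousOn fun t ht => hT t ht) ?_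
    exact fun t ht => (hpos _ (hT t ht)).ne'
  have hk0 : ∀ u, 0 ≤ u → Tendsto (fun t => k (t + u) - k t) atTop (𝓝 0) := by
    intro u hu
    have h1 := ((h (Real.exp u) (Real.exp_pos u)).comp Real.tendsto_exp_atTop).log one_ne_zero
    rw [Real.log_one] at h1
    refine h1.congr' ?_
    filter_upwards [eventually_ge_atTop T] with t ht
    have e1 : Real.exp u * Real.exp t = Real.exp (t + u) := by rw [← Real.exp_add, add_comm]
    simp only [Function.comp, k, e1]
    rw [Real.log_div (hpos _ (hT _ (by linarith))).ne' (hpos _ (hT _ ht)).ne']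
  obtain ⟨C, T', hC⟩ := exists_increment_le_linear hk hk0 (ε := 1 / 2) (by norm_num)
  have hT0 : ∀ t ≥ max T T', 0 < D (Real.exp t) :=
    fun t ht => hpos _ (hT _ ((le_max_left _ _).trans ht))
  have hexp : ∀ t ≥ max T T', ∀ s ≥ max T T',
      D (Real.exp s) ≤ Real.exp C * Real.exp (1 / 2 * |s - t|) * D (Real.exp t) := by
    intro t ht s hs
    have : k s - k t ≤ 1 / 2 * |s - t| + C := by
      rcases le_total t s with hts | hts
      · have := hC t ((le_max_right _ _).trans ht) (s - t) (by linarith)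
        rw [add_sub_cancel] at this
        rw [abs_of_nonneg (by linarith : 0 ≤ s - t)]
        exact (le_abs_self _).trans this
      · have := hC s ((le_max_right _ _).trans hs) (t - s) (by linarith)
        rw [add_sub_cancel, abs_sub_comm] at this
        rw [abs_of_nonpos (by linarith : s - t ≤ 0), neg_sub]
        exact (le_abs_self _).trans this
    have h2 := Real.exp_le_exp.2 this
    rw [Real.exp_sub, Real.exp_log (hT0 s hs), Real.exp_log (hT0 t ht), Real.exp_add,
      div_le_iff₀ (hT0 t ht)] at h2
    linarith
  refine ⟨Real.exp C, Real.exp_pos _, Real.exp (max T T'), Real.exp_pos _, fun x hx => ?_⟩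
  have hx0 : 0 < x := lt_of_lt_of_le (Real.exp_pos _) hx
  have hlx : max T T' ≤ Real.log x := (Real.le_log_iff_exp_le hx0).2 hx
  have hx1 := hT0 _ hlx
  rw [Real.exp_log hx0] at hx1
  refine ⟨hx1, fun r hr hrx => ?_⟩
  have hlrx : max T T' ≤ Real.log (r * x) := (Real.le_log_iff_exp_le (by positivity)).2 hrx
  have h3 := hexp _ hlx _ hlrx
  rw [Real.exp_log hx0, Real.exp_log (by positivity), Real.log_mul hr.ne' hx0.ne',
    add_sub_cancel_right] at h3
  refine h3.trans ?_
  gcongr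
  rw [Real.rpow_def_of_pos hr, Real.rpow_def_of_pos hr]
  rcases le_total 0 (Real.log r) with hl | hl
  · rw [abs_of_nonneg hl, mul_comm]
    exact le_add_of_nonneg_right (Real.exp_pos _).le
  · rw [abs_of_nonpos hl, show 1 / 2 * -Real.log r = Real.log r * -(1 / 2) by ring]
    exact le_add_of_nonneg_left (Real.exp_pos _).le

/-- Apply the result at infinity to `x ↦ D x⁻¹`; the bound is symmetric under `r ↦ r⁻¹`. -/
theorem exists_potterOn_Ioc {D : ℝ → ℝ} {X : ℝ} (hX : 0 < X) (hD : ContinuousOn D (Set.Ioc 0 X))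
    (hpos : ∀ x ∈ Set.Ioc 0 X, 0 < D x)
    (h : ∀ c : ℝ, 0 < c → Tendsto (fun x => D (c * x) / D x) (𝓝[>] 0) (𝓝 1)) :
    ∃ C > 0, ∃ X' > 0, PotterOn D (Set.Ioc 0 X') C := by
  have hinv : ∀ x ∈ Set.Ici X⁻¹, x⁻¹ ∈ Set.Ioc 0 X := fun x hx => by
    have hx0 : 0 < x := lt_of_lt_of_le (by positivity) hx
    exact ⟨by positivity, inv_le_of_inv_le₀ hX hx⟩
  obtain ⟨C, hC, Y, hY, hP⟩ := exists_potterOn_Ici (D := fun x => D x⁻¹) (X := X⁻¹)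
    (hD.comp (continuousOn_inv₀.mono fun x hx => by
        have : 0 < x := lt_of_lt_of_le (by positivity) hx
        exact this.ne') hinv)
    (fun x hx => hpos _ (hinv x hx))
    (fun c hc => by
      have := (h c⁻¹ (by positivity)).comp tendsto_inv_atTop_nhdsGT_zero
      simpa only [Function.comp_def, mul_inv] using this)
  refine ⟨C, hC, Y⁻¹, by positivity, fun x hx => ?_⟩
  have hx0 := hx.1
  obtain ⟨h1, h2⟩ := hP x⁻¹ (by simpa using (le_inv_comm₀ hx0 hY).1 hx.2)
  simp only [inv_inv] at h1 h2
  refine ⟨h1, fun r hr hrx => ?_⟩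
  have h3 := h2 r⁻¹ (by positivity) (by
    rw [← mul_inv]; exact (le_inv_comm₀ hrx.1 hY).1 hrx.2)
  rw [mul_inv, inv_inv, inv_inv, Real.inv_rpow hr.le, Real.inv_rpow hr.le, ← Real.rpow_neg hr.le,
    ← Real.rpow_neg hr.le, neg_neg, add_comm] at h3
  exact h3

/-! ### Abelian theorem for Gaussian averages -/

/-- The weight `r ^ (d - 1) * exp (-r² / 2)` of the norm of a standard Gaussian vector. -/
noncomputable def gaussWeight (d : ℕ) (r : ℝ) : ℝ := r ^ (d - 1) * Real.exp (-(r ^ 2 / 2))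

theorem continuous_gaussWeight (d : ℕ) : Continuous (gaussWeight d) := by
  unfold gaussWeight; fun_prop

theorem gaussWeight_nonneg (d : ℕ) {r : ℝ} (hr : 0 ≤ r) : 0 ≤ gaussWeight d r := by
  unfold gaussWeight; positivity

theorem integrableOn_rpow_mul_gaussWeight (d : ℕ) {s : ℝ} (hs : -1 < s) :
    IntegrableOn (fun r => r ^ s * gaussWeight d r) (Set.Ioi 0) := by
  have h := integrableOn_rpow_mul_exp_neg_mul_sq (b := 1 / 2) (by norm_num)
    (s := s + (d - 1 : ℕ)) (by have : (0 : ℝ) ≤ (d - 1 : ℕ) := by positivity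
                               linarith)
  refine h.congr_fun (fun r hr => ?_) measurableSet_Ioi
  simp only [gaussWeight]
  rw [Real.rpow_add hr, Real.rpow_natCast, mul_assoc]
  congr 3; ring

theorem integrableOn_gaussWeight (d : ℕ) : IntegrableOn (gaussWeight d) (Set.Ioi 0) := by
  simpa using integrableOn_rpow_mul_gaussWeight d (s := 0) (by norm_num)

theorem gaussWeight_div (d : ℕ) (hd : 0 < d) (r s : ℝ) :
    s⁻¹ * gaussWeight d (r / s) =
      (s ^ d)⁻¹ * (r ^ (d - 1) * Real.exp (-((r / s) ^ 2 / 2))) := by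
  obtain ⟨n, rfl⟩ := Nat.exists_eq_add_of_lt hd
  simp only [gaussWeight, zero_add, Nat.add_sub_cancel, div_pow, pow_succ, mul_inv]
  ring

/-- The contribution of the scales outside `U` is negligible. -/
theorem tendsto_integral_compl_div {d : ℕ} (hd : 0 < d) {D M : ℝ → ℝ} {U : Set ℝ} {L : Filter ℝ}
    (hpos : ∀ᶠ s in L, 0 < s) (hDpos : ∀ᶠ s in L, 0 < D s)
    (hint : IntegrableOn (fun r => D r * gaussWeight d r) (Set.Ioi 0))
    (hM0 : ∀ s, 0 ≤ M s)
    (hM : ∀ᶠ s in L, ∀ r, 0 < r → r ∉ U →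
      Real.exp (-((r / s) ^ 2 / 2)) ≤ M s * Real.exp (-(r ^ 2 / 2)))
    (hMlim : Tendsto (fun s => M s * (s ^ d)⁻¹ / D s) L (𝓝 0)) :
    Tendsto (fun s => (∫ r in Set.Ioi 0, Uᶜ.indicator D (r * s) * gaussWeight d r) / D s)
      L (𝓝 0) := by
  set I := ∫ r in Set.Ioi 0, |D r| * gaussWeight d r with hI
  have hint' : IntegrableOn (fun r => |D r| * gaussWeight d r) (Set.Ioi 0) := by
    refine IntegrableOn.congr_fun (Integrable.norm hint) (fun r hr => ?_) measurableSet_Ioi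
    simp only [norm_mul, Real.norm_eq_abs, abs_of_nonneg (gaussWeight_nonneg d (le_of_lt hr))]
  have hlim : Tendsto (fun s => M s * (s ^ d)⁻¹ / D s * I) L (𝓝 0) := by
    simpa using hMlim.mul_const I
  refine squeeze_zero_norm' ?_ hlim
  filter_upwards [hpos, hDpos, hM] with s hs hDs hMs
  rw [norm_div, Real.norm_of_nonneg hDs.le, div_mul_eq_mul_div]
  gcongr
  refine (norm_integral_le_integral_norm _).trans ?_
  -- Undoing the scaling moves `s` from `D` to the Gaussian. Off `U`, the factor `M s` then compares
  -- the Gaussian at scale `s` with that at scale `1`, for which integrability is known.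
  have e1 : ∫ r in Set.Ioi 0, ‖Uᶜ.indicator D (r * s) * gaussWeight d r‖ =
      ∫ r in Set.Ioi 0, (fun ρ => ‖Uᶜ.indicator D ρ‖ * gaussWeight d (ρ / s)) (r * s) := by
    refine setIntegral_congr_fun measurableSet_Ioi fun r hr => ?_
    simp only [norm_mul, mul_div_cancel_right₀ _ hs.ne',
      Real.norm_of_nonneg (gaussWeight_nonneg d (le_of_lt hr))]
  rw [e1, integral_comp_mul_right_Ioi (fun ρ => ‖Uᶜ.indicator D ρ‖ * gaussWeight d (ρ / s)) 0 hs,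
    zero_mul, smul_eq_mul, ← integral_const_mul, hI, ← integral_const_mul]
  refine integral_mono_of_nonneg ?_ (hint'.const_mul _) ?_
  · refine (ae_restrict_iff' measurableSet_Ioi).2 (.of_forall fun r hr => ?_)
    have := gaussWeight_nonneg d (div_nonneg (le_of_lt hr) hs.le)
    simp only [Pi.zero_apply]
    positivity
  · refine (ae_restrict_iff' measurableSet_Ioi).2 (.of_forall fun r (hr : 0 < r) => ?_)
    simp only
    rw [mul_left_comm, gaussWeight_div d hd]
    by_cases hrU : r ∈ U
    · have := hM0 s
      simp only [Set.mem_compl_iff, hrU, not_true, not_false_eq_true, Set.indicator_of_notMem,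
        norm_zero, zero_mul, gaussWeight]
      positivity
    · have := hMs r hr hrU
      rw [Set.indicator_of_mem (by simpa using hrU)]
      simp only [gaussWeight, Real.norm_eq_abs]
      calc |D r| * ((s ^ d)⁻¹ * (r ^ (d - 1) * Real.exp (-((r / s) ^ 2 / 2))))
          ≤ |D r| * ((s ^ d)⁻¹ * (r ^ (d - 1) * (M s * Real.exp (-(r ^ 2 / 2))))) := by gcongr
        _ = _ := by ring

/-- **Abelian theorem** for Gaussian averages of a slowly varying function. -/
theorem tendsto_integral_gaussWeight_div {d : ℕ} (hd : 0 < d) {D M : ℝ → ℝ} {U : Set ℝ}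
    {L : Filter ℝ} [L.IsCountablyGenerated] {C : ℝ} (hDm : Measurable D) (hUm : MeasurableSet U)
    (hpos : ∀ᶠ s in L, 0 < s) (hU : ∀ r, 0 < r → ∀ᶠ s in L, r * s ∈ U)
    (hP : PotterOn D U C)
    (hlim : ∀ r, 0 < r → Tendsto (fun s => D (r * s) / D s) L (𝓝 1))
    (hint : ∀ s, 0 < s → IntegrableOn (fun r => D (r * s) * gaussWeight d r) (Set.Ioi 0))
    (hM0 : ∀ s, 0 ≤ M s)
    (hM : ∀ᶠ s in L, ∀ r, 0 < r → r ∉ U →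
      Real.exp (-((r / s) ^ 2 / 2)) ≤ M s * Real.exp (-(r ^ 2 / 2)))
    (hMlim : Tendsto (fun s => M s * (s ^ d)⁻¹ / D s) L (𝓝 0)) :
    Tendsto (fun s => (∫ r in Set.Ioi 0, D (r * s) * gaussWeight d r) / D s) L
      (𝓝 (∫ r in Set.Ioi 0, gaussWeight d r)) := by
  have hU1 : ∀ᶠ s in L, s ∈ U := by simpa using hU 1 one_pos
  have hDpos : ∀ᶠ s in L, 0 < D s := hU1.mono fun s hs => (hP s hs).1
  have hrem := tendsto_integral_compl_div (U := U) hd hpos hDpos (by simpa using hint 1 one_pos)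
    hM0 hM hMlim
  have hgw := (continuous_gaussWeight d).measurable
  -- On `U` Potter's bound provides the dominating function. The exponent `1/2` keeps `r ^ (-1/2)`
  -- integrable at the origin even for `d = 1`.
  have hmain : Tendsto (fun s => ∫ r in Set.Ioi 0, U.indicator D (r * s) / D s * gaussWeight d r) L
      (𝓝 (∫ r in Set.Ioi 0, gaussWeight d r)) := by
    refine tendsto_integral_filter_of_dominated_convergence
      (fun r => C * (r ^ (1 / 2 : ℝ) * gaussWeight d r + r ^ (-(1 / 2) : ℝ) * gaussWeight d r))
      ?_ ?_ ?_ ?_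
    · refine .of_forall fun s => Measurable.aestronglyMeasurable ?_
      have := hDm.indicator hUm
      fun_prop
    · filter_upwards [hU1] with s hs
      refine (ae_restrict_iff' measurableSet_Ioi).2 (.of_forall fun r (hr : 0 < r) => ?_)
      obtain ⟨h1, h2⟩ := hP s hs
      have hg := gaussWeight_nonneg d hr.le
      rw [norm_mul, Real.norm_of_nonneg hg, ← add_mul, ← mul_assoc, norm_div,
        Real.norm_of_nonneg h1.le]
      gcongr
      rw [div_le_iff₀ h1]
      by_cases hrs : r * s ∈ U
      · rw [Set.indicator_of_mem hrs, Real.norm_of_nonneg (hP _ hrs).1.le]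
        exact h2 r hr hrs
      · rw [Set.indicator_of_notMem hrs, norm_zero]
        -- Potter's bound at `r = 1` reads `D s ≤ 2 * C * D s`, which excludes negative `C`.
        have hC : 0 ≤ C := by
          have h3 := h2 1 one_pos (by simpa using hs)
          simp only [one_mul, Real.one_rpow] at h3
          by_contra! hneg
          nlinarith
        positivity
    · exact ((integrableOn_rpow_mul_gaussWeight d (by norm_num)).add
        (integrableOn_rpow_mul_gaussWeight d (by norm_num))).const_mul C
    · refine (ae_restrict_iff' measurableSet_Ioi).2 (.of_forall fun r (hr : 0 < r) => ?_)
      have : Tendsto (fun s => D (r * s) / D s * gaussWeight d r) L (𝓝 (gaussWeight d r)) := by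
        simpa using (hlim r hr).mul_const (gaussWeight d r)
      refine this.congr' ?_
      filter_upwards [hU r hr] with s hs
      rw [Set.indicator_of_mem hs]
  have hsum := hmain.add hrem
  rw [add_zero] at hsum
  refine hsum.congr' ?_
  filter_upwards [hpos] with s hs
  have hm : Measurable fun r : ℝ => r * s := by fun_prop
  have i1 : IntegrableOn (fun r => U.indicator D (r * s) * gaussWeight d r) (Set.Ioi 0) := by
    refine ((hint s hs).indicator (hm hUm)).congr (.of_forall fun r => ?_)
    by_cases hr : r * s ∈ U <;> simp [Set.indicator, hr]
  have i2 : IntegrableOn (fun r => Uᶜ.indicator D (r * s) * gaussWeight d r) (Set.Ioi 0) := by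
    refine ((hint s hs).indicator (hm hUm.compl)).congr (.of_forall fun r => ?_)
    by_cases hr : r * s ∈ U <;> simp [Set.indicator, hr]
  have e1 : ∀ r, U.indicator D (r * s) / D s * gaussWeight d r =
      U.indicator D (r * s) * gaussWeight d r / D s := fun r => by ring
  simp_rw [e1]
  rw [integral_div, ← add_div, ← integral_add i1 i2]
  congr 1
  refine integral_congr_ae (.of_forall fun r => ?_)
  simp only
  rw [← add_mul, ← Pi.add_apply, Set.indicator_self_add_compl]

/-- Potter's bound read from the moving point `s` to a fixed point `x` limits how fast `D s` can
vanish. -/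
theorem PotterOn.inv_le {D : ℝ → ℝ} {U : Set ℝ} {C : ℝ} (hP : PotterOn D U C) {x s : ℝ}
    (hx : x ∈ U) (hs : s ∈ U) (hx0 : 0 < x) (hs0 : 0 < s) :
    (D s)⁻¹ ≤ C * ((x / s) ^ (1 / 2 : ℝ) + (x / s) ^ (-(1 / 2) : ℝ)) / D x := by
  have h1 := (hP s hs).2 (x / s) (by positivity) (by rwa [div_mul_cancel₀ _ hs0.ne'])
  rw [div_mul_cancel₀ _ hs0.ne'] at h1
  have h2 := (hP s hs).1
  have h3 := (hP x hx).1
  rw [le_div_iff₀ h3, inv_mul_le_iff₀ h2]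
  linarith

/-- Here the excluded scales are `r < Y`, where `exp (-r²/2)` is bounded below, so a constant `M`
suffices. Potter's bound gives `1 / D s = O(s ^ (1/2))`, which loses to `s ^ (-d)`. -/
theorem tendsto_integral_gaussWeight_div_atTop {d : ℕ} (hd : 0 < d) {D : ℝ → ℝ} {X : ℝ}
    (hDm : Measurable D) (hD : ContinuousOn D (Set.Ici X)) (hpos : ∀ x ≥ X, 0 < D x)
    (h : ∀ c : ℝ, 0 < c → Tendsto (fun x => D (c * x) / D x) atTop (𝓝 1))
    (hint : ∀ s, 0 < s → IntegrableOn (fun r => D (r * s) * gaussWeight d r) (Set.Ioi 0)) :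
    Tendsto (fun s => (∫ r in Set.Ioi 0, D (r * s) * gaussWeight d r) / D s) atTop
      (𝓝 (∫ r in Set.Ioi 0, gaussWeight d r)) := by
  obtain ⟨C, hC, Y, hY, hP⟩ := exists_potterOn_Ici hD hpos h
  refine tendsto_integral_gaussWeight_div hd (M := fun _ => Real.exp (Y ^ 2 / 2)) hDm
    measurableSet_Ici (eventually_gt_atTop 0)
    (fun r hr => (tendsto_id.const_mul_atTop hr).eventually_ge_atTop Y)
    hP h hint (fun _ => (Real.exp_pos _).le) (.of_forall fun s r hr hrY => ?_) ?_
  · rw [← Real.exp_add]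
    have hrY' : r < Y := not_le.1 hrY
    refine Real.exp_le_exp.2 ?_
    nlinarith [sq_nonneg (r / s)]
  · have hYD := (hP Y (Set.mem_Ici.2 le_rfl)).1
    have hlim : Tendsto (fun s : ℝ => Real.exp (Y ^ 2 / 2) * (C * 2 * Y ^ (-(1 / 2) : ℝ) / D Y) *
        s ^ (-(1 / 2) : ℝ)) atTop (𝓝 0) := by
      simpa using (tendsto_rpow_neg_atTop (y := 1 / 2) (by norm_num)).const_mul
        (Real.exp (Y ^ 2 / 2) * (C * 2 * Y ^ (-(1 / 2) : ℝ) / D Y))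
    refine squeeze_zero' ?_ ?_ hlim
    · filter_upwards [eventually_ge_atTop Y] with s hs
      have := (hP s hs).1
      have hs0 := hY.trans_le hs
      positivity
    · filter_upwards [eventually_ge_atTop Y, eventually_ge_atTop 1] with s hs hs1
      have hs0 : 0 < s := hY.trans_le hs
      have hDs := (hP s hs).1
      have hinv := hP.inv_le (Set.mem_Ici.2 le_rfl) hs hY hs0
      have hq0 : 0 < Y / s := by positivity
      have hq : Y / s ≤ 1 := (div_le_one hs0).2 hs
      have hq1 : (Y / s) ^ (1 / 2 : ℝ) ≤ (Y / s) ^ (-(1 / 2) : ℝ) :=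
        Real.rpow_le_rpow_of_exponent_ge hq0 hq (by norm_num)
      have hq2 : (Y / s) ^ (-(1 / 2) : ℝ) = Y ^ (-(1 / 2) : ℝ) * s ^ (1 / 2 : ℝ) := by
        rw [Real.div_rpow hY.le hs0.le, Real.rpow_neg hs0.le, div_inv_eq_mul]
      have hsd : (s ^ d)⁻¹ ≤ s⁻¹ := by
        gcongr
        exact le_self_pow₀ hs1 hd.ne'
      have hss : s⁻¹ * s ^ (1 / 2 : ℝ) = s ^ (-(1 / 2) : ℝ) := by
        rw [← Real.rpow_neg_one, ← Real.rpow_add hs0]; norm_num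
      calc Real.exp (Y ^ 2 / 2) * (s ^ d)⁻¹ / D s
          = Real.exp (Y ^ 2 / 2) * ((s ^ d)⁻¹ * (D s)⁻¹) := by ring
        _ ≤ Real.exp (Y ^ 2 / 2) * (s⁻¹ * (C * ((Y / s) ^ (-(1 / 2) : ℝ) +
              (Y / s) ^ (-(1 / 2) : ℝ)) / D Y)) := by
            gcongr
            refine hinv.trans ?_
            gcongr
        _ = Real.exp (Y ^ 2 / 2) * (C * 2 * Y ^ (-(1 / 2) : ℝ) / D Y) *
              (s⁻¹ * s ^ (1 / 2 : ℝ)) := by rw [hq2]; ring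
        _ = _ := by rw [hss]

/-- Now the excluded scales are `r > Y`, and the Gaussian at small scale `s` is tiny there: `M s`
decays like `exp (-Y² / (2 s²))`, faster than any power of `s`. -/
theorem tendsto_integral_gaussWeight_div_nhdsGT_zero {d : ℕ} (hd : 0 < d) {D : ℝ → ℝ} {X : ℝ}
    (hX : 0 < X) (hDm : Measurable D) (hD : ContinuousOn D (Set.Ioc 0 X))
    (hpos : ∀ x ∈ Set.Ioc 0 X, 0 < D x)
    (h : ∀ c : ℝ, 0 < c → Tendsto (fun x => D (c * x) / D x) (𝓝[>] 0) (𝓝 1))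
    (hint : ∀ s, 0 < s → IntegrableOn (fun r => D (r * s) * gaussWeight d r) (Set.Ioi 0)) :
    Tendsto (fun s => (∫ r in Set.Ioi 0, D (r * s) * gaussWeight d r) / D s) (𝓝[>] 0)
      (𝓝 (∫ r in Set.Ioi 0, gaussWeight d r)) := by
  obtain ⟨C, hC, Y, hY, hP⟩ := exists_potterOn_Ioc hX hD hpos h
  have hmul : ∀ r : ℝ, 0 < r → ∀ᶠ s in 𝓝[>] (0 : ℝ), r * s ∈ Set.Ioc 0 Y := by
    intro r hr
    filter_upwards [Ioc_mem_nhdsGT (show (0 : ℝ) < Y / r by positivity)] with s hs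
    refine ⟨mul_pos hr hs.1, ?_⟩
    have := hs.2
    rw [le_div_iff₀ hr] at this
    linarith
  refine tendsto_integral_gaussWeight_div hd
    (M := fun s => Real.exp (-(Y ^ 2 * ((s⁻¹) ^ 2 - 1) / 2))) hDm
    measurableSet_Ioc self_mem_nhdsWithin hmul
    hP h hint (fun _ => (Real.exp_pos _).le) ?_ ?_
  · filter_upwards [Ioc_mem_nhdsGT (show (0 : ℝ) < 1 by norm_num)] with s hs r hr hrY
    rw [← Real.exp_add]
    have hrY' : Y < r := by
      by_contra! hle
      exact hrY ⟨hr, hle⟩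
    refine Real.exp_le_exp.2 ?_
    have h1 : 1 ≤ s⁻¹ := (one_le_inv₀ hs.1).2 hs.2
    have h2 : 0 ≤ (r ^ 2 - Y ^ 2) * (s⁻¹ ^ 2 - 1) := by
      refine mul_nonneg ?_ ?_ <;> nlinarith
    have h3 : (r / s) ^ 2 = r ^ 2 * s⁻¹ ^ 2 := by rw [div_eq_mul_inv, mul_pow]
    rw [h3]
    linarith
  · have hYm : Y ∈ Set.Ioc 0 Y := ⟨hY, le_rfl⟩
    have hYD := (hP Y hYm).1
    set K := Real.exp (Y ^ 2 / 2) * (C * 2 * Y / D Y) with hK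
    have hlim : Tendsto (fun s : ℝ => K * (((s⁻¹) ^ 2) ^ ((d + 1 : ℕ) : ℝ) *
        Real.exp (-(Y ^ 2 / 2) * (s⁻¹) ^ 2))) (𝓝[>] 0) (𝓝 0) := by
      have h1 := tendsto_rpow_mul_exp_neg_mul_atTop_nhds_zero ((d + 1 : ℕ) : ℝ) (Y ^ 2 / 2)
        (by positivity)
      have h2 : Tendsto (fun s : ℝ => (s⁻¹) ^ 2) (𝓝[>] 0) atTop :=
        (tendsto_pow_atTop two_ne_zero).comp tendsto_inv_nhdsGT_zero
      simpa using (h1.comp h2).const_mul K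
    refine squeeze_zero' ?_ ?_ hlim
    · filter_upwards [Ioc_mem_nhdsGT hY] with s hs
      have := (hP s hs).1
      have := hs.1
      positivity
    · filter_upwards [Ioc_mem_nhdsGT hY, Ioc_mem_nhdsGT (show (0 : ℝ) < 1 by norm_num)]
        with s hs hs1
      have hs0 : 0 < s := hs.1
      have hDs := (hP s hs).1
      have hinv := hP.inv_le hYm hs hY hs0
      have hq0 : 0 < Y / s := by positivity
      have hq : 1 ≤ Y / s := (one_le_div hs0).2 hs.2
      have hq1 : (Y / s) ^ (-(1 / 2) : ℝ) ≤ Y / s := by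
        simpa using Real.rpow_le_rpow_of_exponent_le hq (show (-(1 / 2) : ℝ) ≤ 1 by norm_num)
      have hq2 : (Y / s) ^ (1 / 2 : ℝ) ≤ Y / s := by
        simpa using Real.rpow_le_rpow_of_exponent_le hq (show (1 / 2 : ℝ) ≤ 1 by norm_num)
      have ht : 1 ≤ s⁻¹ := (one_le_inv₀ hs0).2 hs1.2
      -- A wasteful power, chosen so that the bound is a function of `(s⁻¹)²`, the variable of the
      -- exponential.
      have hpow : (s⁻¹) ^ (d + 1) ≤ ((s⁻¹) ^ 2) ^ (d + 1) := by
        gcongr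
        exact le_self_pow₀ ht two_ne_zero
      have hexp : Real.exp (-(Y ^ 2 * ((s⁻¹) ^ 2 - 1) / 2)) =
          Real.exp (Y ^ 2 / 2) * Real.exp (-(Y ^ 2 / 2) * (s⁻¹) ^ 2) := by
        rw [← Real.exp_add]; ring_nf
      rw [Real.rpow_natCast]
      calc Real.exp (-(Y ^ 2 * ((s⁻¹) ^ 2 - 1) / 2)) * (s ^ d)⁻¹ / D s
          = Real.exp (-(Y ^ 2 * ((s⁻¹) ^ 2 - 1) / 2)) * ((s ^ d)⁻¹ * (D s)⁻¹) := by ring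
        _ ≤ Real.exp (-(Y ^ 2 * ((s⁻¹) ^ 2 - 1) / 2)) * ((s ^ d)⁻¹ *
              (C * (Y / s + Y / s) / D Y)) := by
            gcongr
            refine hinv.trans ?_
            gcongr
        _ = K * ((s⁻¹) ^ (d + 1) * Real.exp (-(Y ^ 2 / 2) * (s⁻¹) ^ 2)) := by
            rw [hexp, hK, div_eq_mul_inv Y s, ← inv_pow s d, pow_succ (s⁻¹) d]; ring
        _ ≤ _ := by gcongr

/-! ### Moments, Frullani's integral and Gaussian test functions -/

theorem integrable_mul_comp_of_mem_Icc {μ : Measure ℝ} {v W f : ℝ → ℝ} (hv : Integrable v μ)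
    (hW : Continuous W) (hW01 : ∀ y, W y ∈ Set.Icc (0 : ℝ) 1) (hf : Continuous f) :
    Integrable (fun y => v y * f (W y)) μ := by
  obtain ⟨C, hC⟩ := isCompact_Icc.exists_bound_of_continuousOn (s := Set.Icc (0 : ℝ) 1)
    hf.continuousOn
  exact hv.mul_bdd (c := C) (hf.comp hW).aestronglyMeasurable (.of_forall fun y => hC _ (hW01 y))

/-- The method of moments on `[0, 1]`. -/
theorem tendsto_integral_mul_comp_of_moments {ι : Type*} {L : Filter ι} {μ : Measure ℝ}
    {v : ι → ℝ → ℝ} {w W f : ℝ → ℝ} (hv : ∀ᶠ s in L, Integrable (v s) μ)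
    (hv0 : ∀ᶠ s in L, ∀ᵐ y ∂μ, 0 ≤ v s y) (hw : Integrable w μ) (hw0 : ∀ᵐ y ∂μ, 0 ≤ w y)
    (hW : Continuous W) (hW01 : ∀ y, W y ∈ Set.Icc (0 : ℝ) 1)
    (hlim : ∀ k : ℕ, Tendsto (fun s => ∫ y, v s y * W y ^ k ∂μ) L (𝓝 (∫ y, w y * W y ^ k ∂μ)))
    (hf : Continuous f) :
    Tendsto (fun s => ∫ y, v s y * f (W y) ∂μ) L (𝓝 (∫ y, w y * f (W y) ∂μ)) := by
  have hpoly : ∀ p : Polynomial ℝ, Tendsto (fun s => ∫ y, v s y * p.eval (W y) ∂μ) L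
      (𝓝 (∫ y, w y * p.eval (W y) ∂μ)) := by
    intro p
    induction p using Polynomial.induction_on' with
    | add p q hp hq =>
      have e : ∀ u : ℝ → ℝ, Integrable u μ → ∫ y, u y * (p + q).eval (W y) ∂μ =
          ∫ y, u y * p.eval (W y) ∂μ + ∫ y, u y * q.eval (W y) ∂μ := fun u hu => by
        simp_rw [Polynomial.eval_add, mul_add]
        exact integral_add (integrable_mul_comp_of_mem_Icc hu hW hW01 p.continuous)
          (integrable_mul_comp_of_mem_Icc hu hW hW01 q.continuous)
      rw [e w hw]
      refine (hp.add hq).congr' ?_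
      filter_upwards [hv] with s hs using (e _ hs).symm
    | monomial n a =>
      simp_rw [Polynomial.eval_monomial, mul_left_comm _ a, integral_const_mul]
      exact (hlim n).const_mul a
  have herr : ∀ (p : Polynomial ℝ) (ε : ℝ), (∀ x ∈ Set.Icc (0 : ℝ) 1, |p.eval x - f x| < ε) →
      ∀ u : ℝ → ℝ, Integrable u μ → (∀ᵐ y ∂μ, 0 ≤ u y) →
      |∫ y, u y * p.eval (W y) ∂μ - ∫ y, u y * f (W y) ∂μ| ≤ ε * ∫ y, u y ∂μ := by
    intro p ε hp u hu hu0
    rw [← integral_sub (integrable_mul_comp_of_mem_Icc hu hW hW01 p.continuous)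
      (integrable_mul_comp_of_mem_Icc hu hW hW01 hf), ← integral_const_mul,
      ← Real.norm_eq_abs]
    refine norm_integral_le_of_norm_le (hu.const_mul ε) ?_
    filter_upwards [hu0] with y hy
    rw [← mul_sub, norm_mul, Real.norm_of_nonneg hy, mul_comm]
    exact mul_le_mul_of_nonneg_right (hp _ (hW01 y)).le hy
  have h0 : Tendsto (fun s => ∫ y, v s y ∂μ) L (𝓝 (∫ y, w y ∂μ)) := by simpa using hlim 0
  rw [Metric.tendsto_nhds]
  intro η hη
  set I := ∫ y, w y ∂μ with hI
  have hI0 : 0 ≤ I := integral_nonneg_of_ae hw0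
  -- Replacing `f` by a polynomial costs `ε (I + 1)` on the side of `v s` and `ε I` on the side of
  -- `w`; convergence for the polynomial costs another `ε`.
  set ε := η / (2 * I + 2) with hε
  have hε0 : 0 < ε := by positivity
  obtain ⟨p, hp⟩ := exists_polynomial_near_of_continuousOn 0 1 f hf.continuousOn ε hε0
  filter_upwards [hv, hv0, (Metric.tendsto_nhds.1 (hpoly p)) ε hε0,
    h0.eventually (gt_mem_nhds (lt_add_one I))] with s hs hs0 hsp hsI
  rw [Real.dist_eq] at *
  have h1 := herr p ε hp (v s) hs hs0
  have h2 := herr p ε hp w hw hw0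
  have h3 : ε * ∫ y, v s y ∂μ < ε * (I + 1) := by gcongr
  have h4 : ε * (2 * I + 2) = η := by rw [hε]; field_simp
  rw [abs_lt] at *
  rw [abs_le] at *
  constructor <;> nlinarith [h1.1, h1.2, h2.1, h2.2, hsp.1, hsp.2]

/-- The one-dimensional Gaussian profile. -/
noncomputable def gaussProfile (y : ℝ) : ℝ := Real.exp (-(y ^ 2 / 2))

theorem continuous_gaussProfile : Continuous gaussProfile := by unfold gaussProfile; fun_prop

theorem gaussProfile_pos (y : ℝ) : 0 < gaussProfile y := Real.exp_pos _

theorem gaussProfile_le_one (y : ℝ) : gaussProfile y ≤ 1 := by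
  unfold gaussProfile
  exact Real.exp_le_one_iff.2 (by nlinarith [sq_nonneg y])

theorem gaussProfile_lt {x y : ℝ} (hx : 0 ≤ x) (h : x < y) : gaussProfile y < gaussProfile x := by
  unfold gaussProfile
  exact Real.exp_lt_exp.2 (by nlinarith)

theorem gaussProfile_le {x y : ℝ} (hx : 0 ≤ x) (h : x ≤ y) : gaussProfile y ≤ gaussProfile x := by
  unfold gaussProfile
  exact Real.exp_le_exp.2 (by nlinarith)

/-- This is what turns information about dilations into moments in the variable `gaussProfile y`. -/
theorem gaussProfile_pow (n : ℕ) (y : ℝ) :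
    gaussProfile y ^ n = gaussProfile (Real.sqrt n * y) := by
  unfold gaussProfile
  rw [← Real.exp_nat_mul, mul_pow, Real.sq_sqrt (by positivity)]
  ring_nf

/-- By `1 - exp (-u) ≤ u` the difference is `O(y²)` times the profile, so the singularity of `y⁻¹`
is harmless. -/
theorem integrableOn_inv_mul_gaussProfile_sub {b : ℝ} (hb : 1 ≤ b) :
    IntegrableOn (fun y => y⁻¹ * (gaussProfile y - gaussProfile (b * y))) (Set.Ioi 0) := by
  have h := ((integrableOn_gaussWeight 2).const_mul ((b ^ 2 - 1) / 2))
  refine Integrable.mono' h ?_ ((ae_restrict_iff' measurableSet_Ioi).2 (.of_forall ?_))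
  · have := continuous_gaussProfile.measurable
    exact Measurable.aestronglyMeasurable (by fun_prop)
  · intro y (hy : 0 < y)
    have h1 : gaussProfile (b * y) ≤ gaussProfile y :=
      gaussProfile_le hy.le (by nlinarith)
    rw [Real.norm_of_nonneg (mul_nonneg (by positivity) (by linarith)), inv_mul_le_iff₀ hy]
    have h2 : gaussProfile (b * y) =
        gaussProfile y * Real.exp (-((b ^ 2 - 1) * y ^ 2 / 2)) := by
      unfold gaussProfile
      rw [← Real.exp_add]; ring_nf
    have h3 := Real.add_one_le_exp (-((b ^ 2 - 1) * y ^ 2 / 2))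
    have h4 := mul_le_mul_of_nonneg_left h3 (gaussProfile_pos y).le
    have h5 : gaussWeight 2 y = y * gaussProfile y := by simp [gaussWeight, gaussProfile]
    rw [h2, h5]
    nlinarith

/-- Frullani's integral for a profile with value `1` at `0` and limit `0` at infinity. It recognises
`log b` as the transform of `dy / y`. -/
theorem integral_inv_mul_gaussProfile_sub {b : ℝ} (hb : 1 ≤ b) :
    ∫ y in Set.Ioi 0, y⁻¹ * (gaussProfile y - gaussProfile (b * y)) = Real.log b := by
  have h := Frullani.integral_Ioi_eq (f := gaussProfile) (a := 1) (b := b) (L := 1) (R := 0)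
    (continuous_gaussProfile.locallyIntegrable.locallyIntegrableOn _) one_pos (by linarith)
    ?_ ?_ (by simpa using integrableOn_inv_mul_gaussProfile_sub hb)
  · simpa using h
  · have : Tendsto gaussProfile (𝓝 0) (𝓝 (gaussProfile 0)) := continuous_gaussProfile.tendsto 0
    simp only [gaussProfile, ne_eq, OfNat.ofNat_ne_zero, not_false_eq_true, zero_pow, zero_div,
      neg_zero, Real.exp_zero] at this
    exact this.mono_left nhdsWithin_le_nhds
  · unfold gaussProfile
    refine Real.tendsto_exp_atBot.comp (tendsto_neg_atTop_atBot.comp ?_)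
    exact (tendsto_pow_atTop two_ne_zero).atTop_div_const two_pos

/-- A continuous bump on `(α, β)`, divided by `t - t²`, as a function of `t = gaussProfile y`. -/
noncomputable def gaussBump (α β t : ℝ) : ℝ :=
  max 0 ((t - gaussProfile β) * (gaussProfile α - t))

theorem continuous_gaussBump (α β : ℝ) : Continuous (gaussBump α β) := by
  unfold gaussBump; fun_prop

/-- The bump `(t - t²) * gaussBump α β t` at `t = gaussProfile y`. -/
noncomputable def gaussTest (α β y : ℝ) : ℝ :=
  (gaussProfile y - gaussProfile y ^ 2) * gaussBump α β (gaussProfile y)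

theorem continuous_gaussTest (α β : ℝ) : Continuous (gaussTest α β) := by
  have := continuous_gaussBump α β
  have := continuous_gaussProfile
  unfold gaussTest; fun_prop

theorem gaussProfile_sub_sq_nonneg (y : ℝ) : 0 ≤ gaussProfile y - gaussProfile y ^ 2 := by
  nlinarith [gaussProfile_pos y, gaussProfile_le_one y]

theorem gaussTest_nonneg (α β y : ℝ) : 0 ≤ gaussTest α β y :=
  mul_nonneg (gaussProfile_sub_sq_nonneg y) (le_max_left _ _)

theorem gaussTest_eq_zero {α β y : ℝ} (hα : 0 < α) (hαβ : α < β) (hy : 0 < y)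
    (h : y ∉ Set.Icc α β) : gaussTest α β y = 0 := by
  unfold gaussTest gaussBump
  rw [max_eq_left, mul_zero]
  have hab := gaussProfile_lt hα.le hαβ
  rcases lt_or_ge y α with h1 | h1
  · have := gaussProfile_lt hy.le h1
    exact (mul_neg_of_pos_of_neg (by linarith) (by linarith)).le
  · have h2 : β < y := by
      by_contra! h2
      exact h ⟨h1, h2⟩
    have := gaussProfile_lt (hα.trans hαβ).le h2
    exact (mul_neg_of_neg_of_pos (by linarith) (by linarith)).le

theorem gaussTest_pos {α β y : ℝ} (hα : 0 < α) (h : y ∈ Set.Ioo α β) : 0 < gaussTest α β y := by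
  have h1 := gaussProfile_lt hα.le h.1
  have h2 := gaussProfile_lt (hα.trans h.1).le h.2
  refine mul_pos ?_ (lt_max_of_lt_right (mul_pos (by linarith) (by linarith)))
  nlinarith [gaussProfile_pos y, gaussProfile_le_one α]

theorem integrableOn_mul_gaussTest {α β : ℝ} (hα : 0 < α) (hαβ : α < β) {f : ℝ → ℝ}
    (hf : ContinuousOn f (Set.Ioi 0)) :
    IntegrableOn (fun y => f y * gaussTest α β y) (Set.Ioi 0) := by
  have h1 : IntegrableOn (fun y => f y * gaussTest α β y) (Set.Icc α β) :=
    ContinuousOn.integrableOn_Icc ((hf.mono fun y hy => hα.trans_le hy.1).mul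
      (continuous_gaussTest α β).continuousOn)
  refine h1.of_forall_sdiff_eq_zero measurableSet_Ioi fun y hy => ?_
  rw [gaussTest_eq_zero hα hαβ hy.1 hy.2, mul_zero]

theorem integral_pow_mul_gaussTest_pos {α β : ℝ} (hα : 0 < α) (hαβ : α < β) (n : ℕ) :
    0 < ∫ y in Set.Ioi 0, y ^ n * gaussTest α β y := by
  rw [setIntegral_pos_iff_support_of_nonneg_ae]
  · refine lt_of_lt_of_le ?_ (measure_mono (s := Set.Ioo α β) fun y hy => ⟨?_, hα.trans hy.1⟩)
    · simpa using hαβ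
    · have := hα.trans hy.1
      have := gaussTest_pos hα hy
      exact (by positivity : 0 < y ^ n * gaussTest α β y).ne'
  · refine (ae_restrict_iff' measurableSet_Ioi).2 (.of_forall fun y (hy : 0 < y) => ?_)
    have := gaussTest_nonneg α β y
    simp only [Pi.zero_apply]; positivity
  · exact integrableOn_mul_gaussTest hα hαβ (by fun_prop)

/-! ### Tauberian theorem for monotone densities -/

section Tauberian

variable {ι : Type*} {L : Filter ι} {φ : ι → ℝ → ℝ} {d : ℕ} {K : ℝ}

/-- The factor `g - g²`, with `g = gaussProfile`, makes the limit measure `K dy / y` finite near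
`0`. The `k`-th moment involves `g^(k+1) - g^(k+2)`, a difference of two hypotheses with `b =
√(k+2)` and `b = √(k+1)`, so the method of moments applies. -/
theorem tendsto_integral_gaussTest
    (hφ0 : ∀ᶠ s in L, ∀ y, 0 < y → 0 ≤ φ s y) (hK : 0 ≤ K)
    (hint : ∀ᶠ s in L, ∀ b, 0 < b →
      IntegrableOn (fun y => gaussProfile (b * y) * φ s y * y ^ (d - 1)) (Set.Ioi 0))
    (hlim : ∀ b, 1 ≤ b → Tendsto (fun s => ∫ y in Set.Ioi 0,
      (gaussProfile y - gaussProfile (b * y)) * φ s y * y ^ (d - 1)) L (𝓝 (K * Real.log b)))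
    (α β : ℝ) :
    Tendsto (fun s => ∫ y in Set.Ioi 0, gaussTest α β y * φ s y * y ^ (d - 1)) L
      (𝓝 (K * ∫ y in Set.Ioi 0, y⁻¹ * gaussTest α β y)) := by
  have hsub : ∀ᶠ s in L, ∀ b, 0 < b → IntegrableOn (fun y =>
      (gaussProfile y - gaussProfile (b * y)) * φ s y * y ^ (d - 1)) (Set.Ioi 0) := by
    filter_upwards [hint] with s hs b hb
    have h1 := hs 1 one_pos
    simp only [one_mul] at h1
    refine (h1.sub (hs b hb)).congr (.of_forall fun y => ?_)
    simp only [Pi.sub_apply]; ring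
  have hsq : ∀ y, gaussProfile y ^ 2 = gaussProfile (Real.sqrt 2 * y) := fun y => by
    simpa using gaussProfile_pow 2 y
  have hs2 : (1 : ℝ) ≤ Real.sqrt 2 := Real.one_le_sqrt.2 (by norm_num)
  have hk1 : ∀ k : ℕ, 1 ≤ Real.sqrt (k + 1 : ℕ) := fun k => by
    rw [Real.one_le_sqrt]; push_cast; linarith [(Nat.cast_nonneg k : (0 : ℝ) ≤ k)]
  have hexpand : ∀ (k : ℕ) (y : ℝ), (gaussProfile y - gaussProfile y ^ 2) * gaussProfile y ^ k =
      (gaussProfile y - gaussProfile (Real.sqrt (k + 1 + 1 : ℕ) * y)) -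
        (gaussProfile y - gaussProfile (Real.sqrt (k + 1 : ℕ) * y)) := fun k y => by
    rw [← gaussProfile_pow, ← gaussProfile_pow]; ring
  have hA : ∀ n : ℕ, IntegrableOn (fun y => y⁻¹ * (gaussProfile y -
      gaussProfile (Real.sqrt (n + 1 : ℕ) * y))) (Set.Ioi 0) := fun n =>
    integrableOn_inv_mul_gaussProfile_sub (hk1 n)
  have key := tendsto_integral_mul_comp_of_moments (L := L) (μ := volume.restrict (Set.Ioi 0))
    (v := fun s y => (gaussProfile y - gaussProfile y ^ 2) * φ s y * y ^ (d - 1))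
    (w := fun y => K * (y⁻¹ * (gaussProfile y - gaussProfile y ^ 2))) (W := gaussProfile)
    (f := gaussBump α β) ?_ ?_ ?_ ?_ continuous_gaussProfile
    (fun y => ⟨(gaussProfile_pos y).le, gaussProfile_le_one y⟩) ?_ (continuous_gaussBump α β)
  · have e1 : ∀ s y, gaussTest α β y * φ s y * y ^ (d - 1) =
        (gaussProfile y - gaussProfile y ^ 2) * φ s y * y ^ (d - 1) *
          gaussBump α β (gaussProfile y) := fun s y => by simp only [gaussTest]; ring
    have e2 : ∀ y, K * (y⁻¹ * gaussTest α β y) = K * (y⁻¹ * (gaussProfile y -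
        gaussProfile y ^ 2)) * gaussBump α β (gaussProfile y) := fun y => by
      simp only [gaussTest]; ring
    rw [← integral_const_mul]
    simp_rw [e1, e2]
    exact key
  · filter_upwards [hsub] with s hs
    simp_rw [hsq]
    exact hs (Real.sqrt 2) (by positivity)
  · filter_upwards [hφ0] with s hs
    refine (ae_restrict_iff' measurableSet_Ioi).2 (.of_forall fun y (hy : 0 < y) => ?_)
    have := gaussProfile_sub_sq_nonneg y
    have := hs y hy
    positivity
  · simp_rw [hsq]
    exact (integrableOn_inv_mul_gaussProfile_sub hs2).const_mul K
  · refine (ae_restrict_iff' measurableSet_Ioi).2 (.of_forall fun y (hy : 0 < y) => ?_)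
    have := gaussProfile_sub_sq_nonneg y
    positivity
  · intro k
    have e2 : ∫ y in Set.Ioi 0, K * (y⁻¹ * (gaussProfile y - gaussProfile y ^ 2)) *
        gaussProfile y ^ k = K * Real.log (Real.sqrt (k + 1 + 1 : ℕ)) -
          K * Real.log (Real.sqrt (k + 1 : ℕ)) := by
      rw [← mul_sub, ← integral_inv_mul_gaussProfile_sub (hk1 (k + 1)),
        ← integral_inv_mul_gaussProfile_sub (hk1 k), ← integral_sub (hA _) (hA _),
        ← integral_const_mul]
      refine integral_congr_ae (.of_forall fun y => ?_)
      simp only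
      rw [← mul_sub, ← hexpand]; ring
    rw [e2]
    refine ((hlim _ (hk1 (k + 1))).sub (hlim _ (hk1 k))).congr' ?_
    filter_upwards [hsub] with s hs
    rw [← integral_sub (hs _ (by positivity)) (hs _ (by positivity))]
    refine integral_congr_ae (.of_forall fun y => ?_)
    simp only
    rw [← sub_mul, ← sub_mul, ← hexpand]; ring

theorem integrableOn_gaussTest_mul
    (hint : ∀ᶠ s in L, ∀ b, 0 < b →
      IntegrableOn (fun y => gaussProfile (b * y) * φ s y * y ^ (d - 1)) (Set.Ioi 0)) (α β : ℝ) :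
    ∀ᶠ s in L, IntegrableOn (fun y => gaussTest α β y * φ s y * y ^ (d - 1)) (Set.Ioi 0) := by
  filter_upwards [hint] with s hs
  have h1 := hs 1 one_pos
  simp only [one_mul] at h1
  have h2 := integrable_mul_comp_of_mem_Icc (f := fun t => (1 - t) * gaussBump α β t) h1
    continuous_gaussProfile (fun y => ⟨(gaussProfile_pos y).le, gaussProfile_le_one y⟩)
    (by have := continuous_gaussBump α β
        fun_prop)
  refine h2.congr (.of_forall fun y => ?_)
  simp only [gaussTest]; ring

/-- **Tauberian theorem** of de Haan type for monotone densities. -/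
theorem tendsto_apply_one_of_tendsto_integral (hd : 0 < d)
    (hanti : ∀ᶠ s in L, AntitoneOn (φ s) (Set.Ioi 0))
    (hφ0 : ∀ᶠ s in L, ∀ y, 0 < y → 0 ≤ φ s y) (hK : 0 ≤ K)
    (hint : ∀ᶠ s in L, ∀ b, 0 < b →
      IntegrableOn (fun y => gaussProfile (b * y) * φ s y * y ^ (d - 1)) (Set.Ioi 0))
    (hlim : ∀ b, 1 ≤ b → Tendsto (fun s => ∫ y in Set.Ioi 0,
      (gaussProfile y - gaussProfile (b * y)) * φ s y * y ^ (d - 1)) L (𝓝 (K * Real.log b))) :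
    Tendsto (fun s => φ s 1) L (𝓝 K) := by
  have hcont : Tendsto (fun α : ℝ => K * (α ^ d)⁻¹) (𝓝 1) (𝓝 K) := by
    have : ContinuousAt (fun α : ℝ => K * (α ^ d)⁻¹) 1 :=
      ContinuousAt.mul continuousAt_const (ContinuousAt.inv₀ (by fun_prop) (by simp))
    simpa [ContinuousAt] using this
  have hinv : ∀ y : ℝ, 0 < y → y⁻¹ = (y ^ d)⁻¹ * y ^ (d - 1) := fun y hy => by
    obtain ⟨n, rfl⟩ := Nat.exists_eq_add_of_lt hd
    simp only [zero_add, Nat.add_sub_cancel, pow_succ, mul_inv]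
    field_simp
  have hinvint : ∀ {α β : ℝ}, 0 < α → α < β →
      IntegrableOn (fun y => y⁻¹ * gaussTest α β y) (Set.Ioi 0) := fun hα hαβ =>
    integrableOn_mul_gaussTest hα hαβ (continuousOn_inv₀.mono fun y hy => ne_of_gt hy)
  have hpowint : ∀ {α β : ℝ}, 0 < α → α < β →
      IntegrableOn (fun y => y ^ (d - 1) * gaussTest α β y) (Set.Ioi 0) := fun hα hαβ =>
    integrableOn_mul_gaussTest hα hαβ (by fun_prop)
  -- For the lower bound the bump sits on `(1, β)`, where `φ s y ≤ φ s 1` and `y⁻¹ = y^(-d) y^(d-1)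
  -- ≥ β^(-d) y^(d-1)`. The upper bound uses `(α, 1)` with both inequalities reversed. The loss
  -- `β^(-d)` or `α^(-d)` tends to `1`.
  refine tendsto_order.2 ⟨fun u hu => ?_, fun u hu => ?_⟩
  · have h1 : ∀ᶠ β in 𝓝[>] (1 : ℝ), u < K * (β ^ d)⁻¹ :=
      nhdsWithin_le_nhds (hcont.eventually (lt_mem_nhds hu))
    obtain ⟨β, hβu, hβ : 1 < β⟩ := (h1.and self_mem_nhdsWithin).exists
    set J := ∫ y in Set.Ioi 0, y ^ (d - 1) * gaussTest 1 β y with hJ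
    have hJ0 : 0 < J := integral_pow_mul_gaussTest_pos one_pos hβ _
    have hle : K * (β ^ d)⁻¹ * J ≤ K * ∫ y in Set.Ioi 0, y⁻¹ * gaussTest 1 β y := by
      rw [mul_assoc, hJ, ← integral_const_mul]
      refine mul_le_mul_of_nonneg_left (setIntegral_mono_on ((hpowint one_pos hβ).const_mul _)
        (hinvint one_pos hβ) measurableSet_Ioi fun y (hy : 0 < y) => ?_) hK
      by_cases hm : y ∈ Set.Icc 1 β
      · rw [hinv y hy, mul_assoc]
        have := gaussTest_nonneg 1 β y
        gcongr
        exact hm.2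
      · simp [gaussTest_eq_zero one_pos hβ hy hm]
    have hT := tendsto_integral_gaussTest hφ0 hK hint hlim 1 β
    have hlt : u * J < K * ∫ y in Set.Ioi 0, y⁻¹ * gaussTest 1 β y :=
      lt_of_lt_of_le (by gcongr) hle
    filter_upwards [hT.eventually (lt_mem_nhds hlt), hanti, integrableOn_gaussTest_mul hint 1 β]
      with s hs hsa hsi
    have : ∫ y in Set.Ioi 0, gaussTest 1 β y * φ s y * y ^ (d - 1) ≤ φ s 1 * J := by
      rw [hJ, ← integral_const_mul]
      refine setIntegral_mono_on hsi ((hpowint one_pos hβ).const_mul _) measurableSet_Ioi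
        fun y (hy : 0 < y) => ?_
      by_cases hm : y ∈ Set.Icc 1 β
      · have h2 := hsa (Set.mem_Ioi.2 one_pos) hy hm.1
        have h3 := gaussTest_nonneg 1 β y
        calc gaussTest 1 β y * φ s y * y ^ (d - 1)
            ≤ gaussTest 1 β y * φ s 1 * y ^ (d - 1) := by gcongr
          _ = _ := by ring
      · simp [gaussTest_eq_zero one_pos hβ hy hm]
    exact lt_of_mul_lt_mul_right (hs.trans_le this) hJ0.le
  · have h1 : ∀ᶠ α in 𝓝[<] (1 : ℝ), K * (α ^ d)⁻¹ < u :=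
      nhdsWithin_le_nhds (hcont.eventually (gt_mem_nhds hu))
    have h2 : ∀ᶠ α in 𝓝[<] (1 : ℝ), 0 < α := nhdsWithin_le_nhds (lt_mem_nhds one_pos)
    obtain ⟨α, ⟨hαu, hα0⟩, hα : α < 1⟩ := ((h1.and h2).and self_mem_nhdsWithin).exists
    set J := ∫ y in Set.Ioi 0, y ^ (d - 1) * gaussTest α 1 y with hJ
    have hJ0 : 0 < J := integral_pow_mul_gaussTest_pos hα0 hα _
    have hle : K * ∫ y in Set.Ioi 0, y⁻¹ * gaussTest α 1 y ≤ K * (α ^ d)⁻¹ * J := by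
      rw [mul_assoc, hJ, ← integral_const_mul ((α ^ d)⁻¹)]
      refine mul_le_mul_of_nonneg_left (setIntegral_mono_on (hinvint hα0 hα)
        ((hpowint hα0 hα).const_mul _) measurableSet_Ioi fun y (hy : 0 < y) => ?_) hK
      by_cases hm : y ∈ Set.Icc α 1
      · rw [hinv y hy, mul_assoc]
        have := gaussTest_nonneg α 1 y
        gcongr
        exact hm.1
      · simp [gaussTest_eq_zero hα0 hα hy hm]
    have hT := tendsto_integral_gaussTest hφ0 hK hint hlim α 1
    have hlt : K * ∫ y in Set.Ioi 0, y⁻¹ * gaussTest α 1 y < u * J :=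
      lt_of_le_of_lt hle (by gcongr)
    filter_upwards [hT.eventually (gt_mem_nhds hlt), hanti, integrableOn_gaussTest_mul hint α 1]
      with s hs hsa hsi
    have : φ s 1 * J ≤ ∫ y in Set.Ioi 0, gaussTest α 1 y * φ s y * y ^ (d - 1) := by
      rw [hJ, ← integral_const_mul]
      refine setIntegral_mono_on ((hpowint hα0 hα).const_mul _) hsi measurableSet_Ioi
        fun y (hy : 0 < y) => ?_
      by_cases hm : y ∈ Set.Icc α 1
      · have h2 := hsa hy (Set.mem_Ioi.2 one_pos) hm.2
        have h3 := gaussTest_nonneg α 1 y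
        calc φ s 1 * (y ^ (d - 1) * gaussTest α 1 y)
            = gaussTest α 1 y * φ s 1 * y ^ (d - 1) := by ring
          _ ≤ _ := by gcongr
      · simp [gaussTest_eq_zero hα0 hα hy hm]
    exact lt_of_mul_lt_mul_right (this.trans_lt hs) hJ0.le

end Tauberian

/-! ### Increments of the reciprocal of a de Haan function -/

section Increments

variable {ψ l : ℝ → ℝ} {L : Filter ℝ}

/-- A zero of `l` would make the quotient at `c = 1` equal to `0` by the convention for division,
not close to `1`. -/
theorem eventually_pos_of_tendsto_div (hl0 : ∀ᶠ x in L, 0 ≤ l x)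
    (hl : ∀ c : ℝ, 0 < c → Tendsto (fun x => l (c * x) / l x) L (𝓝 1)) : ∀ᶠ x in L, 0 < l x := by
  filter_upwards [hl0, (hl 1 one_pos).eventually_ne one_ne_zero] with x hx hx'
  refine hx.lt_of_ne fun h => hx' ?_
  rw [← h, div_zero]

/-- The auxiliary function of a nonnegative function in the de Haan class is negligible. -/
theorem tendsto_div_atTop_of_deHaan (hmul : ∀ c : ℝ, 0 < c → Tendsto (fun x => c * x) L L)
    (hψ0 : ∀ᶠ x in L, 0 ≤ ψ x) (hl0 : ∀ᶠ x in L, 0 < l x)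
    (hψ : ∀ c : ℝ, 0 < c → Tendsto (fun x => (ψ (c * x) - ψ x) / l x) L (𝓝 (Real.log c))) :
    Tendsto (fun x => ψ x / l x) L atTop := by
  refine tendsto_atTop.2 fun N => ?_
  -- With `c = exp (-(N + 1))` the increment is below `-N * l x`, and `ψ (c * x) ≥ 0` forces `ψ x ≥
  -- N * l x`.
  have h1 := hψ (Real.exp (-(N + 1))) (Real.exp_pos _)
  rw [Real.log_exp] at h1
  filter_upwards [h1.eventually (gt_mem_nhds (show -(N + 1) < -N by linarith)), hl0,
    (hmul _ (Real.exp_pos (-(N + 1)))).eventually hψ0] with x hx hlx hψx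
  rw [le_div_iff₀ hlx]
  rw [div_lt_iff₀ hlx] at hx
  linarith

theorem tendsto_div_of_deHaan (hmul : ∀ c : ℝ, 0 < c → Tendsto (fun x => c * x) L L)
    (hψ0 : ∀ᶠ x in L, 0 ≤ ψ x) (hl0 : ∀ᶠ x in L, 0 < l x)
    (hψ : ∀ c : ℝ, 0 < c → Tendsto (fun x => (ψ (c * x) - ψ x) / l x) L (𝓝 (Real.log c)))
    {c : ℝ} (hc : 0 < c) : Tendsto (fun x => ψ (c * x) / ψ x) L (𝓝 1) := by
  have h0 := tendsto_div_atTop_of_deHaan hmul hψ0 hl0 hψ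
  have h1 := ((hψ c hc).mul h0.inv_tendsto_atTop).add_const 1
  rw [mul_zero, zero_add] at h1
  refine h1.congr' ?_
  filter_upwards [hl0, h0.eventually_gt_atTop 0] with x hx hx'
  have hψx : 0 < ψ x := (div_pos_iff_of_pos_right hx).1 hx'
  simp only [Pi.inv_apply]
  field_simp
  ring

/-- The increment `1 / ψ x - 1 / ψ (b x)`. -/
noncomputable def invIncrement (ψ : ℝ → ℝ) (b x : ℝ) : ℝ := (ψ x)⁻¹ - (ψ (b * x))⁻¹

/-- The increment equals `(ψ(bx) - ψ(x)) / (ψ(x) ψ(bx))`, and `ψ(bx)` is equivalent to `ψ(x)`. -/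
theorem tendsto_invIncrement_div (hmul : ∀ c : ℝ, 0 < c → Tendsto (fun x => c * x) L L)
    (hψ0 : ∀ᶠ x in L, 0 ≤ ψ x) (hl0 : ∀ᶠ x in L, 0 < l x)
    (hψ : ∀ c : ℝ, 0 < c → Tendsto (fun x => (ψ (c * x) - ψ x) / l x) L (𝓝 (Real.log c)))
    {b : ℝ} (hb : 0 < b) :
    Tendsto (fun x => invIncrement ψ b x / ((ψ x ^ 2)⁻¹ * l x)) L (𝓝 (Real.log b)) := by
  have h0 := tendsto_div_atTop_of_deHaan hmul hψ0 hl0 hψ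
  have h1 := (hψ b hb).mul ((tendsto_div_of_deHaan hmul hψ0 hl0 hψ hb).inv₀ one_ne_zero)
  rw [inv_one, mul_one] at h1
  refine h1.congr' ?_
  have hpos : ∀ᶠ x in L, 0 < ψ x := by
    filter_upwards [hl0, h0.eventually_gt_atTop 0] with x hx hx'
    exact (div_pos_iff_of_pos_right hx).1 hx'
  filter_upwards [hl0, hpos, (hmul b hb).eventually hpos] with x hx hψx hψbx
  unfold invIncrement
  field_simp

theorem eventually_pos_of_deHaan (hmul : ∀ c : ℝ, 0 < c → Tendsto (fun x => c * x) L L)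
    (hψ0 : ∀ᶠ x in L, 0 ≤ ψ x) (hl0 : ∀ᶠ x in L, 0 < l x)
    (hψ : ∀ c : ℝ, 0 < c → Tendsto (fun x => (ψ (c * x) - ψ x) / l x) L (𝓝 (Real.log c))) :
    ∀ᶠ x in L, 0 < ψ x := by
  filter_upwards [hl0, (tendsto_div_atTop_of_deHaan hmul hψ0 hl0 hψ).eventually_gt_atTop 0]
    with x hx hx'
  exact (div_pos_iff_of_pos_right hx).1 hx'

theorem eventually_invIncrement_pos (hmul : ∀ c : ℝ, 0 < c → Tendsto (fun x => c * x) L L)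
    (hψ0 : ∀ᶠ x in L, 0 ≤ ψ x) (hl0 : ∀ᶠ x in L, 0 < l x)
    (hψ : ∀ c : ℝ, 0 < c → Tendsto (fun x => (ψ (c * x) - ψ x) / l x) L (𝓝 (Real.log c)))
    {b : ℝ} (hb : 1 < b) : ∀ᶠ x in L, 0 < invIncrement ψ b x := by
  filter_upwards [hl0, eventually_pos_of_deHaan hmul hψ0 hl0 hψ,
    (tendsto_invIncrement_div hmul hψ0 hl0 hψ (one_pos.trans hb)).eventually
      (lt_mem_nhds (Real.log_pos hb))] with x hx hψx h
  exact (div_pos_iff_of_pos_right (by positivity)).1 h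

/-- The increment is equivalent to `log b * l / ψ²` with `log b ≠ 0`, and both `l` and `ψ` vary
slowly. This qualifies it for the Abelian theorem. -/
theorem tendsto_invIncrement_mul_div (hmul : ∀ c : ℝ, 0 < c → Tendsto (fun x => c * x) L L)
    (hψ0 : ∀ᶠ x in L, 0 ≤ ψ x) (hl0 : ∀ᶠ x in L, 0 < l x)
    (hl : ∀ c : ℝ, 0 < c → Tendsto (fun x => l (c * x) / l x) L (𝓝 1))
    (hψ : ∀ c : ℝ, 0 < c → Tendsto (fun x => (ψ (c * x) - ψ x) / l x) L (𝓝 (Real.log c)))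
    {b c : ℝ} (hb : 1 < b) (hc : 0 < c) :
    Tendsto (fun x => invIncrement ψ b (c * x) / invIncrement ψ b x) L (𝓝 1) := by
  have hb0 := one_pos.trans hb
  have hlog := (Real.log_pos hb).ne'
  have h1 := tendsto_invIncrement_div hmul hψ0 hl0 hψ hb0
  have hpos := eventually_pos_of_deHaan hmul hψ0 hl0 hψ
  have h2 := (((h1.comp (hmul c hc)).mul (h1.inv₀ hlog)).mul (hl c hc)).mul
    (((tendsto_div_of_deHaan hmul hψ0 hl0 hψ hc).inv₀ one_ne_zero).pow 2)
  rw [mul_inv_cancel₀ hlog, inv_one, one_pow, mul_one, mul_one] at h2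
  refine h2.congr' ?_
  filter_upwards [hl0, hpos, (hmul c hc).eventually hpos, (hmul c hc).eventually hl0,
    eventually_invIncrement_pos hmul hψ0 hl0 hψ hb] with x hx hψx hψcx hlcx hD
  simp only [Function.comp]
  field_simp

end Increments

/-! ### From the Gaussian identity to the asymptotics of the profile -/

/-- Both sides of the Gaussian identity for the potential measure, in polar coordinates:
`φ` is the radial profile of the potential density and `ψ` that of the exponent. -/
structure GaussianPotentialIdentity (d : ℕ) (φ ψ : ℝ → ℝ) (A σ κ : ℝ) : Prop where
  antitone : AntitoneOn φ (Set.Ioi 0)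
  nonneg : ∀ y, 0 < y → 0 ≤ φ y
  sigma_pos : 0 < σ
  normalized : κ * ∫ r in Set.Ioi 0, gaussWeight d r = 1
  integrable_left : ∀ s, 0 < s →
    IntegrableOn (fun y => gaussProfile (s * y) * φ y * y ^ (d - 1)) (Set.Ioi 0)
  integrable_right : ∀ s, 0 < s →
    IntegrableOn (fun r => (ψ (r * s))⁻¹ * gaussWeight d r) (Set.Ioi 0)
  identity : ∀ s, 0 < s →
    A + σ * ∫ y in Set.Ioi 0, gaussProfile (s * y) * φ y * y ^ (d - 1) =
      κ * ∫ r in Set.Ioi 0, (ψ (r * s))⁻¹ * gaussWeight d r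

namespace GaussianPotentialIdentity

variable {d : ℕ} {φ ψ l : ℝ → ℝ} {A σ κ : ℝ}

theorem integrable_invIncrement (h : GaussianPotentialIdentity d φ ψ A σ κ) {b s : ℝ} (hb : 0 < b)
    (hs : 0 < s) : IntegrableOn (fun r => invIncrement ψ b (r * s) * gaussWeight d r)
      (Set.Ioi 0) := by
  refine ((h.integrable_right s hs).sub (h.integrable_right (b * s) (by positivity))).congr
    (.of_forall fun r => ?_)
  simp only [Pi.sub_apply, invIncrement]
  rw [show r * (b * s) = b * (r * s) by ring, sub_mul]

theorem rescale (hd : 0 < d) {s b : ℝ} (hs : 0 < s) (f : ℝ → ℝ) :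
    ∫ y in Set.Ioi 0, (gaussProfile y - gaussProfile (b * y)) * ((s ^ d)⁻¹ * f (y / s)) *
        y ^ (d - 1) =
      ∫ y in Set.Ioi 0, (gaussProfile (s * y) - gaussProfile (b * s * y)) * f y *
        y ^ (d - 1) := by
  have h1 := integral_comp_mul_right_Ioi (fun y => (gaussProfile y - gaussProfile (b * y)) *
    ((s ^ d)⁻¹ * f (y / s)) * y ^ (d - 1)) 0 hs
  rw [zero_mul, smul_eq_mul, eq_inv_mul_iff_mul_eq₀ hs.ne', ← integral_const_mul] at h1
  rw [← h1]
  refine setIntegral_congr_fun measurableSet_Ioi fun y _ => ?_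
  simp only [mul_div_cancel_right₀ _ hs.ne']
  obtain ⟨n, rfl⟩ := Nat.exists_eq_add_of_lt hd
  simp only [zero_add, Nat.add_sub_cancel, mul_pow]
  rw [show y * s = s * y by ring, show b * (s * y) = b * s * y by ring, pow_succ]
  field_simp

/-- Subtracting the identities at `s` and `b * s` cancels the atom `A`. -/
theorem integral_sub_eq (h : GaussianPotentialIdentity d φ ψ A σ κ) {b s : ℝ}
    (hb : 0 < b) (hs : 0 < s) :
    ∫ y in Set.Ioi 0, (gaussProfile (s * y) - gaussProfile (b * s * y)) * φ y * y ^ (d - 1) =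
      σ⁻¹ * (κ * ∫ r in Set.Ioi 0, invIncrement ψ b (r * s) * gaussWeight d r) := by
  have hbs : 0 < b * s := by positivity
  have h1 := h.identity s hs
  have h2 := h.identity (b * s) hbs
  have e1 : ∫ r in Set.Ioi 0, invIncrement ψ b (r * s) * gaussWeight d r =
      (∫ r in Set.Ioi 0, (ψ (r * s))⁻¹ * gaussWeight d r) -
        ∫ r in Set.Ioi 0, (ψ (r * (b * s)))⁻¹ * gaussWeight d r := by
    rw [← integral_sub (h.integrable_right s hs) (h.integrable_right (b * s) hbs)]
    refine integral_congr_ae (.of_forall fun r => ?_)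
    simp only [invIncrement]
    rw [show r * (b * s) = b * (r * s) by ring, sub_mul]
  have e2 : ∫ y in Set.Ioi 0, (gaussProfile (s * y) - gaussProfile (b * s * y)) * φ y *
      y ^ (d - 1) = (∫ y in Set.Ioi 0, gaussProfile (s * y) * φ y * y ^ (d - 1)) -
        ∫ y in Set.Ioi 0, gaussProfile (b * s * y) * φ y * y ^ (d - 1) := by
    rw [← integral_sub (h.integrable_left s hs) (h.integrable_left (b * s) hbs)]
    refine integral_congr_ae (.of_forall fun r => ?_)
    simp only; ring
  rw [e1, e2, eq_inv_mul_iff_mul_eq₀ h.sigma_pos.ne']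
  linarith

/-- The Tauberian theorem is applied to `φ_s(y) = s^(-d) φ(y/s) ψ(s)² / l(s)` with `K = σ⁻¹`; its
value at `y = 1` is the quotient sought. -/
theorem tendsto_of_abelian (h : GaussianPotentialIdentity d φ ψ A σ κ) (hd : 0 < d)
    {L : Filter ℝ} (hpos : ∀ᶠ s in L, 0 < s)
    (hmul : ∀ c : ℝ, 0 < c → Tendsto (fun x => c * x) L L)
    (hψ0 : ∀ᶠ x in L, 0 ≤ ψ x) (hl0 : ∀ᶠ x in L, 0 < l x)
    (hψ : ∀ c : ℝ, 0 < c → Tendsto (fun x => (ψ (c * x) - ψ x) / l x) L (𝓝 (Real.log c)))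
    (habel : ∀ b, 1 < b → Tendsto (fun s =>
      (∫ r in Set.Ioi 0, invIncrement ψ b (r * s) * gaussWeight d r) / invIncrement ψ b s) L
      (𝓝 (∫ r in Set.Ioi 0, gaussWeight d r))) :
    Tendsto (fun s => φ s⁻¹ / (s ^ d * (ψ s ^ 2)⁻¹ * l s)) L (𝓝 σ⁻¹) := by
  have hψpos := eventually_pos_of_deHaan hmul hψ0 hl0 hψ
  have hscale : ∀ s y : ℝ, (s ^ d)⁻¹ * (φ (y / s) / ((ψ s ^ 2)⁻¹ * l s)) =
      φ (y / s) / (s ^ d * (ψ s ^ 2)⁻¹ * l s) := fun s y => by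
    simp only [div_eq_mul_inv, mul_inv]; ring
  have key := tendsto_apply_one_of_tendsto_integral (L := L) (d := d) (K := σ⁻¹)
    (φ := fun s y => (s ^ d)⁻¹ * (φ (y / s) / ((ψ s ^ 2)⁻¹ * l s))) hd ?_ ?_
    (inv_nonneg.2 h.sigma_pos.le) ?_ ?_
  · refine key.congr fun s => ?_
    rw [hscale, one_div]
  · filter_upwards [hpos, hψpos, hl0] with s hs hψs hls x hx y hy hxy
    have := h.antitone (div_pos hx hs : x / s ∈ Set.Ioi 0) (div_pos hy hs : y / s ∈ Set.Ioi 0)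
      (by gcongr)
    simp only
    gcongr
  · filter_upwards [hpos, hψpos, hl0] with s hs hψs hls y hy
    have := h.nonneg (y / s) (by positivity)
    positivity
  · filter_upwards [hpos, hψpos, hl0] with s hs hψs hls b hb
    have h1 := h.integrable_left (b * s) (by positivity)
    have h2 := (integrableOn_Ioi_comp_mul_right_iff (fun y => gaussProfile (b * y) *
      ((s ^ d)⁻¹ * (φ (y / s) / ((ψ s ^ 2)⁻¹ * l s))) * y ^ (d - 1)) 0 hs).1
    rw [zero_mul] at h2
    refine h2 ?_
    refine (h1.const_mul ((s ^ d)⁻¹ * ((ψ s ^ 2)⁻¹ * l s)⁻¹ * s ^ (d - 1))).congr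
      (.of_forall fun y => ?_)
    simp only [mul_div_cancel_right₀ _ hs.ne', mul_pow]
    rw [show b * (y * s) = b * s * y by ring]
    ring
  · intro b hb
    rcases hb.eq_or_lt with rfl | hb1
    · simpa using tendsto_const_nhds
    · have hb0 := one_pos.trans hb1
      have h1 := (((habel b hb1).mul (tendsto_invIncrement_div hmul hψ0 hl0 hψ hb0)).const_mul
        κ).const_mul σ⁻¹
      -- The normalization absorbs both `κ` and the limit in the Abelian theorem, leaving `σ⁻¹ * log
      -- b`.
      rw [← mul_assoc κ, h.normalized, one_mul] at h1
      refine h1.congr' ?_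
      filter_upwards [hpos, eventually_invIncrement_pos hmul hψ0 hl0 hψ hb1] with s hs hD
      rw [rescale hd hs (fun y => φ y / ((ψ s ^ 2)⁻¹ * l s))]
      simp_rw [← mul_div_assoc, div_mul_eq_mul_div]
      rw [integral_div, h.integral_sub_eq hb0 hs]
      generalize (∫ r in Set.Ioi 0, invIncrement ψ b (r * s) * gaussWeight d r) = J
      field_simp

theorem tendsto_atTop (h : GaussianPotentialIdentity d φ ψ A σ κ) (hd : 0 < d)
    (hψc : Continuous ψ) (hl : SlowlyVaryingAtInfty l) (hψ : ψ ∈ deHaanAtInfty l) :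
    Tendsto (fun s => φ s⁻¹ / (s ^ d * (ψ s ^ 2)⁻¹ * l s)) atTop (𝓝 σ⁻¹) := by
  have hmul : ∀ c : ℝ, 0 < c → Tendsto (fun x : ℝ => c * x) atTop atTop := fun c hc =>
    tendsto_id.const_mul_atTop hc
  have hl0 := eventually_pos_of_tendsto_div hl.1 hl.2
  refine h.tendsto_of_abelian hd (eventually_gt_atTop 0) hmul hψ.1 hl0 hψ.2 fun b hb => ?_
  have hb0 := one_pos.trans hb
  have hψpos := eventually_pos_of_deHaan hmul hψ.1 hl0 hψ.2
  obtain ⟨X, hX⟩ := eventually_atTop.1 (hψpos.and (((hmul b hb0).eventually hψpos).and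
    (eventually_invIncrement_pos hmul hψ.1 hl0 hψ.2 hb)))
  have hm := hψc.measurable
  refine tendsto_integral_gaussWeight_div_atTop hd (X := X) ?_ ?_ (fun x hx => (hX x hx).2.2)
    (fun c hc => tendsto_invIncrement_mul_div hmul hψ.1 hl0 hl.2 hψ.2 hb hc)
    fun s hs => h.integrable_invIncrement hb0 hs
  · unfold invIncrement; fun_prop
  · unfold invIncrement
    exact (hψc.continuousOn.inv₀ fun x hx => (hX x hx).1.ne').sub
      ((by fun_prop : ContinuousOn (fun x => ψ (b * x)) _).inv₀ fun x hx => (hX x hx).2.1.ne')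

theorem tendsto_nhdsGT_zero (h : GaussianPotentialIdentity d φ ψ A σ κ) (hd : 0 < d)
    (hψc : Continuous ψ) (hl : SlowlyVaryingAtZero l) (hψ : ψ ∈ deHaanAtZero l) :
    Tendsto (fun s => φ s⁻¹ / (s ^ d * (ψ s ^ 2)⁻¹ * l s)) (𝓝[>] 0) (𝓝 σ⁻¹) := by
  have hmul : ∀ c : ℝ, 0 < c → Tendsto (fun x : ℝ => c * x) (𝓝[>] 0) (𝓝[>] 0) := fun c hc => by
    refine tendsto_nhdsWithin_iff.2 ⟨?_, ?_⟩
    · have : Tendsto (fun x : ℝ => c * x) (𝓝 0) (𝓝 (c * 0)) :=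
        (continuous_const.mul continuous_id).tendsto 0
      rw [mul_zero] at this
      exact this.mono_left nhdsWithin_le_nhds
    · filter_upwards [self_mem_nhdsWithin] with x hx using mul_pos hc hx
  have hl0 := hl.1
  have hl1 : ∀ c : ℝ, 0 < c → Tendsto (fun x => l (c * x) / l x) (𝓝[>] 0) (𝓝 1) := fun c hc => by
    have := (hl.2.2 c⁻¹ (by positivity)).comp tendsto_inv_nhdsGT_zero
    simpa [Function.comp_def, mul_inv, mul_comm] using this
  have hψ0 : ∀ᶠ x in 𝓝[>] (0 : ℝ), 0 ≤ ψ x := hψ.1.mono fun _ h => h.le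
  refine h.tendsto_of_abelian hd self_mem_nhdsWithin hmul hψ0 hl0 hψ.2 fun b hb => ?_
  have hb0 := one_pos.trans hb
  obtain ⟨X, hX0, hX⟩ := mem_nhdsGT_iff_exists_Ioc_subset.1 (hψ.1.and (((hmul b hb0).eventually
    hψ.1).and (eventually_invIncrement_pos hmul hψ0 hl0 hψ.2 hb)))
  have hm := hψc.measurable
  refine tendsto_integral_gaussWeight_div_nhdsGT_zero hd (X := X) hX0 ?_ ?_
    (fun x hx => (hX hx).2.2)
    (fun c hc => tendsto_invIncrement_mul_div hmul hψ0 hl0 hl1 hψ.2 hb hc)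
    fun s hs => h.integrable_invIncrement hb0 hs
  · unfold invIncrement; fun_prop
  · unfold invIncrement
    exact (hψc.continuousOn.inv₀ fun x hx => (hX hx).1.ne').sub
      ((by fun_prop : ContinuousOn (fun x => ψ (b * x)) _).inv₀ fun x hx => (hX hx).2.1.ne')

end GaussianPotentialIdentity

/-! ### Canonical unimodal densities and their mixtures -/

section UnimodalDensity

variable {d : ℕ}

/-- The thin annulus of inner radius `r` and width `1 / (n + 1)`. -/
def thinAnnulus (d : ℕ) (r : ℝ) (n : ℕ) : Set (EuclideanSpace ℝ (Fin d)) :=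
  {y | r < ‖y‖ ∧ ‖y‖ < r + 1 / (n + 1)}

/-- The right limit at `r` of the radial density of `m`. -/
noncomputable def outerDensity (m : Measure (EuclideanSpace ℝ (Fin d))) (r : ℝ) : ℝ≥0∞ :=
  ⨆ n : ℕ, m (thinAnnulus d r n) / volume (thinAnnulus d r n)

theorem isOpen_thinAnnulus (r : ℝ) (n : ℕ) : IsOpen (thinAnnulus d r n) :=
  (isOpen_lt continuous_const continuous_norm).inter (isOpen_lt continuous_norm continuous_const)

theorem zero_notMem_thinAnnulus {r : ℝ} (hr : 0 ≤ r) (n : ℕ) : 0 ∉ thinAnnulus d r n := by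
  rintro ⟨h, -⟩
  rw [norm_zero] at h
  linarith

theorem volume_thinAnnulus_ne_top (r : ℝ) (n : ℕ) : volume (thinAnnulus d r n) ≠ ∞ := by
  refine ((measure_mono (t := Metric.ball 0 (r + 1 / (n + 1))) fun y hy => ?_).trans_lt
    measure_ball_lt_top).ne
  simpa using hy.2

/-- Densities chosen separately for each time need not be measurable in time. The canonical version
is a countable supremum of ratios of masses of measurable sections, hence jointly measurable. -/
theorem measurable_outerDensity_kernel {κ : Kernel ℝ (EuclideanSpace ℝ (Fin d))}
    [IsSFiniteKernel κ] :
    Measurable fun q : ℝ × EuclideanSpace ℝ (Fin d) => outerDensity (κ q.1) ‖q.2‖ := by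
  have key : ∀ (η : Kernel ℝ (EuclideanSpace ℝ (Fin d))) [IsSFiniteKernel η] (n : ℕ),
      Measurable fun q : ℝ × EuclideanSpace ℝ (Fin d) => η q.1 (thinAnnulus d ‖q.2‖ n) := by
    intro η _ n
    let s : Set ((ℝ × EuclideanSpace ℝ (Fin d)) × EuclideanSpace ℝ (Fin d)) :=
      {z | ‖z.1.2‖ < ‖z.2‖} ∩ {z | ‖z.2‖ < ‖z.1.2‖ + 1 / (n + 1)}
    have hs : MeasurableSet s :=
      (measurableSet_lt (by fun_prop) (by fun_prop)).inter
        (measurableSet_lt (by fun_prop) (by fun_prop))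
    exact Kernel.measurable_kernel_prodMk_left (κ := η.comap Prod.fst measurable_fst) hs
  have hvol : ∀ n : ℕ, Measurable fun x : EuclideanSpace ℝ (Fin d) =>
      volume (thinAnnulus d ‖x‖ n) := fun n => by
    have := (key (Kernel.const ℝ volume) n).comp (measurable_prodMk_left (x := (0 : ℝ)))
    simpa [Function.comp_def] using this
  exact Measurable.iSup fun n => (key κ n).div ((hvol n).comp measurable_snd)

variable {m : Measure (EuclideanSpace ℝ (Fin d))} {p : EuclideanSpace ℝ (Fin d) → ℝ≥0}

theorem IsUnimodalDensity.outerDensity_le (h : IsUnimodalDensity m p)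
    {x : EuclideanSpace ℝ (Fin d)} (hx : x ≠ 0) : outerDensity m ‖x‖ ≤ p x := by
  refine iSup_le fun n => ENNReal.div_le_of_le_mul ?_
  have hm := (isOpen_thinAnnulus (d := d) ‖x‖ n).measurableSet
  rw [h.2 _ hm (zero_notMem_thinAnnulus (norm_nonneg x) n), ← setLIntegral_const]
  exact setLIntegral_mono' hm fun y hy => by exact_mod_cast h.1 x y hx hy.1.le

theorem IsUnimodalDensity.eq_of_norm_eq {m : Set (EuclideanSpace ℝ (Fin d)) → ℝ≥0∞}
    (h : IsUnimodalDensity m p) {x y : EuclideanSpace ℝ (Fin d)} (hx : x ≠ 0) (hxy : ‖x‖ = ‖y‖) :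
    p x = p y := by
  have hy : y ≠ 0 := by rwa [← norm_ne_zero_iff, ← hxy, norm_ne_zero_iff]
  exact le_antisymm (h.1 y x hy hxy.ge) (h.1 x y hx hxy.le)

variable [NeZero d]

theorem norm_single_zero (r : ℝ) :
    ‖(EuclideanSpace.single (0 : Fin d) r : EuclideanSpace ℝ (Fin d))‖ = |r| := by
  simp

theorem volume_thinAnnulus_ne_zero {r : ℝ} (hr : 0 ≤ r) (n : ℕ) :
    volume (thinAnnulus d r n) ≠ 0 := by
  refine (isOpen_thinAnnulus r n).measure_ne_zero volume
    ⟨EuclideanSpace.single (0 : Fin d) (r + 1 / (n + 1) / 2), ?_⟩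
  have h : (0 : ℝ) < 1 / (n + 1) := by positivity
  simp only [thinAnnulus, Set.mem_ofPred_eq, norm_single_zero]
  rw [abs_of_nonneg (by positivity)]
  constructor <;> linarith

/-- Some annulus beyond `r` is thin enough to lie inside the ball of radius `‖x‖`, where the density
is at least `p x`; so is its average. -/
theorem IsUnimodalDensity.le_outerDensity (h : IsUnimodalDensity m p)
    {x : EuclideanSpace ℝ (Fin d)} {r : ℝ} (hr : 0 ≤ r) (hx : r < ‖x‖) :
    p x ≤ outerDensity m r := by
  obtain ⟨n, hn⟩ := exists_nat_one_div_lt (sub_pos.2 hx)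
  refine le_iSup_of_le n ?_
  have hm := (isOpen_thinAnnulus (d := d) r n).measurableSet
  rw [ENNReal.le_div_iff_mul_le (.inl (volume_thinAnnulus_ne_zero hr n))
    (.inl (volume_thinAnnulus_ne_top r n)), h.2 _ hm (zero_notMem_thinAnnulus hr n),
    ← setLIntegral_const]
  refine setLIntegral_mono' hm fun y hy => ?_
  have hy0 : y ≠ 0 := fun h0 => zero_notMem_thinAnnulus hr n (h0 ▸ hy)
  exact_mod_cast h.1 y x hy0 (by linarith [hy.2])

theorem IsUnimodalDensity.eq_single_norm {m : Set (EuclideanSpace ℝ (Fin d)) → ℝ≥0∞}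
    (h : IsUnimodalDensity m p) {x : EuclideanSpace ℝ (Fin d)} (hx : x ≠ 0) :
    p x = p (EuclideanSpace.single (0 : Fin d) ‖x‖) :=
  h.eq_of_norm_eq hx (by simp)

/-- The radial profile of `p`, extended to an antitone function on the line. -/
noncomputable def radialExtension (p : EuclideanSpace ℝ (Fin d) → ℝ≥0) (r : ℝ) : ℝ≥0∞ :=
  if r ≤ 0 then ⊤ else p (EuclideanSpace.single (0 : Fin d) r)

theorem IsUnimodalDensity.antitone_radialExtension {m : Set (EuclideanSpace ℝ (Fin d)) → ℝ≥0∞}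
    (h : IsUnimodalDensity m p) : Antitone (radialExtension p) := by
  intro r s hrs
  by_cases hr : r ≤ 0
  · simp [radialExtension, hr]
  · have hr' := not_le.1 hr
    have hs : ¬ s ≤ 0 := by linarith
    simp only [radialExtension, hr, hs, if_false]
    refine ENNReal.coe_le_coe.2 (h.1 _ _ (by simpa using hr'.ne') ?_)
    simpa [abs_of_pos hr', abs_of_pos (hr'.trans_le hrs)] using hrs

theorem IsUnimodalDensity.eq_radialExtension {m : Set (EuclideanSpace ℝ (Fin d)) → ℝ≥0∞}
    (h : IsUnimodalDensity m p) {x : EuclideanSpace ℝ (Fin d)} (hx : x ≠ 0) :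
    (p x : ℝ≥0∞) = radialExtension p ‖x‖ := by
  simp only [radialExtension, not_le.2 (norm_pos_iff.2 hx), if_false]
  rw [h.eq_single_norm hx]

theorem IsUnimodalDensity.aemeasurable {m : Set (EuclideanSpace ℝ (Fin d)) → ℝ≥0∞}
    (h : IsUnimodalDensity m p) : AEMeasurable p := by
  have h1 : Measurable fun x : EuclideanSpace ℝ (Fin d) => (radialExtension p ‖x‖).toNNReal :=
    (h.antitone_radialExtension.measurable.comp measurable_norm).ennreal_toNNReal
  refine h1.aemeasurable.congr ?_
  filter_upwards [Measure.ae_ne volume 0] with x hx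
  rw [← h.eq_radialExtension hx, ENNReal.toNNReal_coe]

/-- A monotone profile has countably many discontinuities, and the corresponding spheres are null
sets. Elsewhere the right limit is the value. -/
theorem IsUnimodalDensity.outerDensity_ae_eq (h : IsUnimodalDensity m p) :
    ∀ᵐ x : EuclideanSpace ℝ (Fin d), outerDensity m ‖x‖ = p x := by
  set f := radialExtension p
  have hf : Antitone f := h.antitone_radialExtension
  have hS : ∀ᵐ x : EuclideanSpace ℝ (Fin d), ‖x‖ ∉ {r | ¬ ContinuousAt f r} := by
    have hc := hf.countable_not_continuousAt
    have : volume (⋃ r ∈ {r | ¬ ContinuousAt f r},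
        Metric.sphere (0 : EuclideanSpace ℝ (Fin d)) r) = 0 :=
      (measure_biUnion_null_iff hc).2 fun r _ => Measure.addHaar_sphere _ _ _
    filter_upwards [measure_eq_zero_iff_ae_notMem.1 this] with x hx hx'
    exact hx (Set.mem_biUnion hx' (by simp))
  filter_upwards [hS, Measure.ae_ne volume 0] with x hx hx0
  refine le_antisymm (h.outerDensity_le hx0) ?_
  have hc : ContinuousAt f ‖x‖ := by simpa using hx
  have hx1 : 0 < ‖x‖ := norm_pos_iff.2 hx0
  rw [h.eq_radialExtension hx0]
  refine le_of_tendsto (hc.tendsto.mono_left (nhdsWithin_le_nhds (s := Set.Ioi ‖x‖))) ?_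
  filter_upwards [self_mem_nhdsWithin] with r (hr : ‖x‖ < r)
  have hr0 := hx1.trans hr
  simp only [f, radialExtension, not_le.2 hr0, if_false]
  exact h.le_outerDensity hx1.le (by simpa [abs_of_pos hr0] using hr)

theorem IsUnimodalDensity.outerDensity_antitone (h : IsUnimodalDensity m p) {r s : ℝ}
    (hr : 0 < r) (hrs : r ≤ s) : outerDensity m s ≤ outerDensity m r := by
  rcases hrs.eq_or_lt with rfl | hlt
  · rfl
  · have hs := hr.trans hlt
    have h1 := h.outerDensity_le (x := EuclideanSpace.single (0 : Fin d) s) (by simpa using hs.ne')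
    rw [norm_single_zero, abs_of_pos hs] at h1
    exact h1.trans (h.le_outerDensity hr.le (by simpa [abs_of_pos hs] using hlt))

theorem IsUnimodalDensity.measure_eq (h : IsUnimodalDensity m p)
    {A : Set (EuclideanSpace ℝ (Fin d))} (hA : MeasurableSet A) (hA0 : 0 ∉ A) :
    m A = ∫⁻ x in A, outerDensity m ‖x‖ := by
  rw [h.2 A hA hA0]
  exact lintegral_congr_ae (ae_restrict_of_ae (h.outerDensity_ae_eq.mono fun x hx => hx.symm))

/-- A mixture of unimodal laws which is finite on balls is unimodal. -/
theorem exists_isUnimodalDensity_bind {κ : Kernel ℝ (EuclideanSpace ℝ (Fin d))}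
    [IsSFiniteKernel κ] {ρ : Measure ℝ} [SFinite ρ]
    (h : ∀ᵐ t ∂ρ, ∃ p : EuclideanSpace ℝ (Fin d) → ℝ≥0, IsUnimodalDensity (κ t) p)
    (hfin : ∀ r, (ρ.bind κ) (Metric.closedBall 0 r) < ∞) :
    ∃ g : EuclideanSpace ℝ (Fin d) → ℝ≥0, IsUnimodalDensity (ρ.bind κ) g := by
  let g : ℝ → ℝ≥0∞ := fun r => ∫⁻ t, outerDensity (κ t) r ∂ρ
  have hanti : ∀ r s, 0 < r → r ≤ s → g s ≤ g r := fun r s hr hrs =>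
    lintegral_mono_ae (h.mono fun t ⟨p, hp⟩ => hp.outerDensity_antitone hr hrs)
  have hmeas := measurable_outerDensity_kernel (κ := κ)
  have hdens : ∀ A : Set (EuclideanSpace ℝ (Fin d)), MeasurableSet A → 0 ∉ A →
      (ρ.bind κ) A = ∫⁻ x in A, g ‖x‖ := by
    intro A hA hA0
    rw [Measure.bind_apply hA κ.measurable.aemeasurable,
      lintegral_lintegral_swap (f := fun x t => outerDensity (κ t) ‖x‖)]
    · exact lintegral_congr_ae (h.mono fun t ⟨p, hp⟩ => hp.measure_eq hA hA0)
    · exact (hmeas.comp measurable_swap).aemeasurable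
  -- By monotonicity an infinite value at `r` would give infinite mass to the punctured ball of
  -- radius `r`.
  have hlt : ∀ r, 0 < r → g r < ∞ := by
    intro r hr
    set A : Set (EuclideanSpace ℝ (Fin d)) := Metric.ball 0 r \ {0} with hA
    have hAm : MeasurableSet A := measurableSet_ball.diff (measurableSet_singleton 0)
    have h1 : g r * volume A ≤ (ρ.bind κ) A := by
      rw [hdens A hAm (by simp [hA]), ← setLIntegral_const]
      refine setLIntegral_mono' hAm fun x hx => hanti _ _ (norm_pos_iff.2 hx.2) ?_
      simpa using (Metric.mem_ball.1 hx.1).le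
    have h2 : (ρ.bind κ) A < ∞ := (measure_mono (Set.sdiff_subset.trans
      Metric.ball_subset_closedBall)).trans_lt (hfin r)
    have h3 : volume A ≠ 0 := by
      rw [hA, measure_sdiff_null (measure_singleton _)]
      exact (Metric.measure_ball_pos volume _ hr).ne'
    by_contra! htop
    rw [top_le_iff] at htop
    rw [htop, ENNReal.top_mul h3] at h1
    exact absurd h2 (not_lt.2 h1)
  refine ⟨fun x => (g ‖x‖).toNNReal, fun x y hx hxy => ?_, fun A hA hA0 => ?_⟩
  · have hx0 := norm_pos_iff.2 hx
    exact ENNReal.toNNReal_mono (hlt _ hx0).ne (hanti _ _ hx0 hxy)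
  · rw [hdens A hA hA0]
    refine setLIntegral_congr_fun hA fun x hx => ?_
    have hx0 : x ≠ 0 := fun h0 => hA0 (h0 ▸ hx)
    exact (ENNReal.coe_toNNReal (hlt _ (norm_pos_iff.2 hx0)).ne).symm

end UnimodalDensity

/-! ### Gaussian averages and characteristic functions -/

section GaussianIdentity

variable {d : ℕ}

/-- Fubini, together with the fact that the Fourier transform of a Gaussian is Gaussian. -/
theorem integral_gaussian_eq_integral_charFun (μ : Measure (EuclideanSpace ℝ (Fin d)))
    [IsFiniteMeasure μ] (s : ℝ) :
    ∫ ξ : EuclideanSpace ℝ (Fin d), (Real.exp (-(‖ξ‖ ^ 2 / 2)) : ℂ) * charFun μ (s • ξ) =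
      (((2 * Real.pi) ^ ((d : ℝ) / 2) * ∫ x, gaussProfile (s * ‖x‖) ∂μ : ℝ) : ℂ) := by
  have hinner : ∀ x : EuclideanSpace ℝ (Fin d),
      ∫ ξ : EuclideanSpace ℝ (Fin d), (Real.exp (-(‖ξ‖ ^ 2 / 2)) : ℂ) *
        Complex.exp (⟪x, s • ξ⟫ * Complex.I) =
      (((2 * Real.pi) ^ ((d : ℝ) / 2) * gaussProfile (s * ‖x‖) : ℝ) : ℂ) := by
    intro x
    have h := GaussianFourier.integral_cexp_neg_mul_sq_norm_add (b := 1 / 2) (by norm_num)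
      (s * Complex.I) x
    rw [finrank_euclideanSpace_fin] at h
    have e1 : ∀ ξ : EuclideanSpace ℝ (Fin d), (Real.exp (-(‖ξ‖ ^ 2 / 2)) : ℂ) *
        Complex.exp (⟪x, s • ξ⟫ * Complex.I) =
          Complex.exp (-(1 / 2) * ‖ξ‖ ^ 2 + s * Complex.I * ⟪x, ξ⟫) := fun ξ => by
      rw [inner_smul_right, Complex.ofReal_exp, ← Complex.exp_add]
      push_cast
      ring_nf
    simp_rw [e1]
    rw [h]
    unfold gaussProfile
    rw [Complex.ofReal_mul, Complex.ofReal_cpow (by positivity), Complex.ofReal_exp]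
    push_cast
    congr 2
    · ring
    · rw [mul_pow, Complex.I_sq]; ring
  simp_rw [charFun_apply, ← integral_const_mul]
  rw [integral_integral_swap]
  · simp_rw [hinner]
    rw [integral_complex_ofReal, integral_const_mul]
  · have hg : Integrable fun ξ : EuclideanSpace ℝ (Fin d) => (Real.exp (-(‖ξ‖ ^ 2 / 2)) : ℂ) := by
      have := GaussianFourier.integrable_cexp_neg_mul_sq_norm_add (V := EuclideanSpace ℝ (Fin d))
        (b := 1 / 2) (by norm_num) 0 0
      refine this.congr (.of_forall fun ξ => ?_)
      simp only [Complex.ofReal_exp]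
      push_cast
      simp only [zero_mul, add_zero]
      ring_nf
    refine ((hg.comp_fst μ).mul_bdd (c := 1) ?_ (.of_forall fun z => ?_) :)
    · exact Continuous.aestronglyMeasurable (by fun_prop)
    · rw [Complex.norm_exp_ofReal_mul_I]

theorem integrable_exp_neg_sq_norm :
    Integrable fun ξ : EuclideanSpace ℝ (Fin d) => Real.exp (-(‖ξ‖ ^ 2 / 2)) := by
  have := (GaussianFourier.integrable_cexp_neg_mul_sq_norm_add (V := EuclideanSpace ℝ (Fin d))
    (b := 1 / 2) (by norm_num) 0 0).norm
  refine this.congr (.of_forall fun ξ => ?_)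
  simp only [Complex.norm_exp]
  congr 1
  simp [← Complex.ofReal_pow]
  ring

/-- The normalizing constant of the standard Gaussian density. -/
noncomputable def gaussConst (d : ℕ) : ℝ := ((2 * Real.pi) ^ ((d : ℝ) / 2))⁻¹

theorem gaussConst_pos (d : ℕ) : 0 < gaussConst d := by unfold gaussConst; positivity

/-- Stated with values in `ℝ≥0∞` so that it can later be integrated over time by Tonelli, with no
integrability to check. -/
theorem lintegral_gaussProfile_eq {μ : Measure (EuclideanSpace ℝ (Fin d))} [IsFiniteMeasure μ]
    {a : EuclideanSpace ℝ (Fin d) → ℝ} (ha : Continuous a) (ha0 : ∀ ξ, 0 ≤ a ξ)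
    (h : ∀ ξ, charFun μ ξ = Complex.exp ((-a ξ : ℝ) : ℂ)) (s : ℝ) :
    ∫⁻ x, ENNReal.ofReal (gaussProfile (s * ‖x‖)) ∂μ =
      ∫⁻ ξ, ENNReal.ofReal (gaussConst d * Real.exp (-(‖ξ‖ ^ 2 / 2))) *
        ENNReal.ofReal (Real.exp (-a (s • ξ))) := by
  have h1 := integral_gaussian_eq_integral_charFun μ s
  simp_rw [h, ← Complex.ofReal_exp, ← Complex.ofReal_mul] at h1
  rw [integral_complex_ofReal, Complex.ofReal_inj] at h1
  have hgi : Integrable (fun x => gaussProfile (s * ‖x‖)) μ := by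
    have hc := continuous_gaussProfile
    refine Integrable.of_bound (C := 1) (Continuous.aestronglyMeasurable (by fun_prop))
      (.of_forall fun x => ?_)
    rw [Real.norm_of_nonneg (gaussProfile_pos _).le]
    exact gaussProfile_le_one _
  have hri : Integrable fun ξ : EuclideanSpace ℝ (Fin d) =>
      Real.exp (-(‖ξ‖ ^ 2 / 2)) * Real.exp (-a (s • ξ)) := by
    refine integrable_exp_neg_sq_norm.mul_bdd (c := 1)
      (Continuous.aestronglyMeasurable (by fun_prop)) (.of_forall fun ξ => ?_)
    rw [Real.norm_of_nonneg (Real.exp_pos _).le]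
    exact Real.exp_le_one_iff.2 (by linarith [ha0 (s • ξ)])
  have hc0 := gaussConst_pos d
  simp_rw [← ENNReal.ofReal_mul (mul_nonneg hc0.le (Real.exp_pos _).le), mul_assoc]
  rw [← ofReal_integral_eq_lintegral_ofReal hgi (.of_forall fun x => (gaussProfile_pos _).le),
    ← ofReal_integral_eq_lintegral_ofReal (hri.const_mul _) (.of_forall fun x => by positivity),
    integral_const_mul, h1, gaussConst, inv_mul_cancel_left₀ (by positivity)]

theorem lintegral_exp_neg_mul_Ioi {a : ℝ} (ha : 0 ≤ a) :
    ∫⁻ t in Set.Ioi (0 : ℝ), ENNReal.ofReal (Real.exp (-(t * a))) = (ENNReal.ofReal a)⁻¹ := by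
  rcases ha.eq_or_lt with rfl | ha
  · simp
  · have e : ∀ t : ℝ, -(t * a) = -a * t := fun t => by ring
    simp_rw [e]
    rw [← ofReal_integral_eq_lintegral_ofReal (integrableOn_exp_mul_Ioi (by linarith) 0)
      (.of_forall fun x => (Real.exp_pos _).le), integral_exp_mul_Ioi (by linarith) 0,
      ← ENNReal.ofReal_inv_of_pos ha]
    congr 1
    simp

end GaussianIdentity

/-! ### The exponent and the potential measure of the process -/

section LevyPotential

variable {d : ℕ} {Ω : Type*} [MeasurableSpace Ω] {P : Measure Ω}
  {X : ℝ≥0 → Ω → EuclideanSpace ℝ (Fin d)} {ν : Measure (EuclideanSpace ℝ (Fin d))}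

theorem levyExponent_nonneg (ν : Measure (EuclideanSpace ℝ (Fin d)))
    (ξ : EuclideanSpace ℝ (Fin d)) : 0 ≤ levyExponent ν ξ :=
  integral_nonneg fun x => by simpa using Real.cos_le_one _

/-- Off the origin the density is radial and Lebesgue measure is invariant; the origin is fixed by
`R`, so an atom there is preserved. -/
theorem IsUnimodalDensity.map_linearIsometryEquiv {m : Measure (EuclideanSpace ℝ (Fin d))}
    {p : EuclideanSpace ℝ (Fin d) → ℝ≥0} (h : IsUnimodalDensity m p)
    (R : EuclideanSpace ℝ (Fin d) ≃ₗᵢ[ℝ] EuclideanSpace ℝ (Fin d)) : m.map R = m := by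
  have hR : Measurable R := R.continuous.measurable
  have key : ∀ A : Set (EuclideanSpace ℝ (Fin d)), MeasurableSet A → 0 ∉ A → m (R ⁻¹' A) = m A := by
    intro A hA hA0
    rw [h.2 _ (hR hA) (by simpa using hA0), h.2 A hA hA0,
      ← R.measurePreserving.setLIntegral_comp_preimage_emb R.toHomeomorph.measurableEmbedding
        (fun x => (p x : ℝ≥0∞)) A]
    refine setLIntegral_congr_fun (hR hA) fun x hx => ?_
    have hx0 : x ≠ 0 := fun h0 => hA0 (by simpa [h0] using hx)
    rw [h.eq_of_norm_eq hx0 (R.norm_map x).symm]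
  ext A hA
  rw [Measure.map_apply hR hA]
  by_cases h0 : (0 : EuclideanSpace ℝ (Fin d)) ∈ A
  · have hc : MeasurableSet (A \ {0}) := hA.diff (measurableSet_singleton 0)
    have h1 := key (A \ {0}) hc (by simp)
    have e1 : R ⁻¹' (A \ {0}) = R ⁻¹' A \ {0} := by ext x; simp
    rw [e1] at h1
    rw [← measure_sdiff_add_inter (R ⁻¹' A) (measurableSet_singleton 0),
      ← measure_sdiff_add_inter A (measurableSet_singleton 0), h1,
      Set.inter_eq_right.2 (by simpa using h0), Set.inter_eq_right.2 (by simpa using h0)]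
  · exact key A hA h0

/-- The reflection exchanging `ξ` and `η` preserves the law. -/
theorem IsUnimodalDensity.charFun_eq_of_norm_eq {m : Measure (EuclideanSpace ℝ (Fin d))}
    {p : EuclideanSpace ℝ (Fin d) → ℝ≥0} (h : IsUnimodalDensity m p)
    {ξ η : EuclideanSpace ℝ (Fin d)} (hξη : ‖ξ‖ = ‖η‖) : charFun m ξ = charFun m η := by
  set R := (ℝ ∙ (ξ - η))ᗮ.reflection with hR
  have hRξ : R ξ = η := Submodule.reflection_sub hξη
  have hRm : Measurable R := R.continuous.measurable
  have hexp : ∀ ζ : EuclideanSpace ℝ (Fin d), Continuous fun x : EuclideanSpace ℝ (Fin d) =>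
    Complex.exp (⟪x, ζ⟫ * Complex.I) := fun ζ => by fun_prop
  conv_rhs => rw [← h.map_linearIsometryEquiv R]
  rw [charFun_apply, charFun_apply, integral_map hRm.aemeasurable
    (hexp η).aestronglyMeasurable]
  simp_rw [← hRξ, R.inner_map_map]

/-- Reading the exponent off the law at time `1` gives its continuity and radiality without any
analysis of `ν`. -/
theorem IsIsotropicUnimodalLevyProcess.levyExponent_eq
    (hX : IsIsotropicUnimodalLevyProcess X P ν) (ξ : EuclideanSpace ℝ (Fin d)) :
    levyExponent ν ξ = -Real.log ‖charFun (P.map (X 1)) ξ‖ := by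
  rw [hX.charFun_eq, Complex.norm_exp, Complex.ofReal_re, Real.log_exp]
  simp

theorem IsIsotropicUnimodalLevyProcess.levyExponent_eq_of_norm_eq
    (hX : IsIsotropicUnimodalLevyProcess X P ν) {ξ η : EuclideanSpace ℝ (Fin d)}
    (h : ‖ξ‖ = ‖η‖) : levyExponent ν ξ = levyExponent ν η := by
  obtain ⟨p, hp⟩ := hX.unimodal 1 one_pos
  rw [hX.levyExponent_eq, hX.levyExponent_eq,
    IsUnimodalDensity.charFun_eq_of_norm_eq (m := P.map (X 1)) hp h]

variable [IsProbabilityMeasure P]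

theorem IsIsotropicUnimodalLevyProcess.isProbabilityMeasure_map
    (hX : IsIsotropicUnimodalLevyProcess X P ν) (t : ℝ≥0) : IsProbabilityMeasure (P.map (X t)) :=
  Measure.isProbabilityMeasure_map (hX.measurable t).aemeasurable

theorem IsIsotropicUnimodalLevyProcess.continuous_levyExponent
    (hX : IsIsotropicUnimodalLevyProcess X P ν) : Continuous (levyExponent ν) := by
  have := hX.isProbabilityMeasure_map 1
  rw [funext hX.levyExponent_eq]
  refine (Continuous.log (by fun_prop) fun ξ => ?_).neg
  rw [hX.charFun_eq]
  simp

/-- The characteristic functions are continuous in time, so the laws are weakly continuous by Lévy's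
theorem. Masses of open sets are then lower semicontinuous, and open sets generate the Borel sets.
-/
theorem IsIsotropicUnimodalLevyProcess.measurable_map
    (hX : IsIsotropicUnimodalLevyProcess X P ν) :
    Measurable fun t : ℝ => P.map (X t.toNNReal) := by
  have hprob := hX.isProbabilityMeasure_map
  let μ : ℝ → ProbabilityMeasure (EuclideanSpace ℝ (Fin d)) :=
    fun t => ⟨P.map (X t.toNNReal), hprob _⟩
  have hcont : Continuous μ := by
    refine SeqContinuous.continuous fun u t hu => ?_
    refine ProbabilityMeasure.tendsto_of_tendsto_charFun fun ξ => ?_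
    simp only [μ, Function.comp, ProbabilityMeasure.coe_mk, hX.charFun_eq]
    have : Continuous fun t : ℝ =>
        Complex.exp ((-(t.toNNReal * levyExponent ν ξ) : ℝ) : ℂ) := by fun_prop
    exact (this.tendsto t).comp hu
  refine Measurable.measure_of_isPiSystem_of_isProbabilityMeasure
    (BorelSpace.measurable_eq.trans rfl) isPiSystem_isOpen fun U hU => ?_
  refine LowerSemicontinuous.measurable fun t y hy => ?_
  have h1 := ProbabilityMeasure.le_liminf_measure_open_of_tendsto (hcont.tendsto t) hU
  exact eventually_lt_of_lt_liminf (lt_of_lt_of_le hy h1)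

/-- The laws of the process, as a kernel in time. -/
noncomputable def IsIsotropicUnimodalLevyProcess.lawKernel
    (hX : IsIsotropicUnimodalLevyProcess X P ν) : Kernel ℝ (EuclideanSpace ℝ (Fin d)) :=
  ⟨fun t => P.map (X t.toNNReal), hX.measurable_map⟩

theorem IsIsotropicUnimodalLevyProcess.lawKernel_apply
    (hX : IsIsotropicUnimodalLevyProcess X P ν) (t : ℝ) :
    hX.lawKernel t = P.map (X t.toNNReal) := rfl

instance IsIsotropicUnimodalLevyProcess.isMarkovKernel_lawKernel
    (hX : IsIsotropicUnimodalLevyProcess X P ν) : IsMarkovKernel hX.lawKernel :=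
  ⟨fun t => hX.isProbabilityMeasure_map t.toNNReal⟩

/-- The potential measure as a Borel measure. -/
noncomputable def IsIsotropicUnimodalLevyProcess.potential
    (hX : IsIsotropicUnimodalLevyProcess X P ν) : Measure (EuclideanSpace ℝ (Fin d)) :=
  (volume.restrict (Set.Ioi 0)).bind hX.lawKernel

theorem IsIsotropicUnimodalLevyProcess.potential_apply
    (hX : IsIsotropicUnimodalLevyProcess X P ν) {A : Set (EuclideanSpace ℝ (Fin d))}
    (hA : MeasurableSet A) : hX.potential A = potentialMeasure X P A := by
  rw [potential, Measure.bind_apply hA hX.lawKernel.measurable.aemeasurable]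
  refine lintegral_congr fun t => ?_
  rw [hX.lawKernel_apply, Measure.map_apply (hX.measurable _) hA]

theorem IsIsotropicUnimodalLevyProcess.potential_closedBall_lt_top
    (hX : IsIsotropicUnimodalLevyProcess X P ν) (htrans : IsTransient X P) (r : ℝ) :
    hX.potential (Metric.closedBall 0 r) < ∞ := by
  rw [hX.potential_apply Metric.isClosed_closedBall.measurableSet]
  exact htrans _ (isCompact_closedBall 0 r)

theorem IsIsotropicUnimodalLevyProcess.isUnimodalDensity_potential_iff
    (hX : IsIsotropicUnimodalLevyProcess X P ν) {g : EuclideanSpace ℝ (Fin d) → ℝ≥0} :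
    IsUnimodalDensity hX.potential g ↔ IsUnimodalDensity (potentialMeasure X P) g := by
  refine and_congr_right fun _ => forall₃_congr fun A hA _ => ?_
  rw [hX.potential_apply hA]

theorem IsIsotropicUnimodalLevyProcess.exists_isUnimodalDensity [NeZero d]
    (hX : IsIsotropicUnimodalLevyProcess X P ν) (htrans : IsTransient X P) :
    ∃ g : EuclideanSpace ℝ (Fin d) → ℝ≥0, IsUnimodalDensity (potentialMeasure X P) g := by
  simp_rw [← hX.isUnimodalDensity_potential_iff]
  refine exists_isUnimodalDensity_bind ?_ (hX.potential_closedBall_lt_top htrans)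
  refine (ae_restrict_iff' measurableSet_Ioi).2 (.of_forall fun t (ht : 0 < t) => ?_)
  exact hX.unimodal t.toNNReal (by simpa using ht)

/-- Tonelli and `∫ exp (-t a) dt = 1/a`; zeros of the exponent are allowed, the inverse being `∞`
there. -/
theorem IsIsotropicUnimodalLevyProcess.lintegral_gaussProfile_potential
    (hX : IsIsotropicUnimodalLevyProcess X P ν) (s : ℝ) :
    ∫⁻ x, ENNReal.ofReal (gaussProfile (s * ‖x‖)) ∂hX.potential =
      ∫⁻ ξ, ENNReal.ofReal (gaussConst d * Real.exp (-(‖ξ‖ ^ 2 / 2))) *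
        (ENNReal.ofReal (levyExponent ν (s • ξ)))⁻¹ := by
  have hgc := continuous_gaussProfile
  have hψ := hX.continuous_levyExponent
  have hm : Measurable fun x : EuclideanSpace ℝ (Fin d) =>
      ENNReal.ofReal (gaussProfile (s * ‖x‖)) := by fun_prop
  rw [potential, Measure.lintegral_bind hX.lawKernel.measurable.aemeasurable hm.aemeasurable]
  have e1 : ∀ t ∈ Set.Ioi (0 : ℝ), ∫⁻ x, ENNReal.ofReal (gaussProfile (s * ‖x‖))
      ∂(hX.lawKernel t) = ∫⁻ ξ, ENNReal.ofReal (gaussConst d * Real.exp (-(‖ξ‖ ^ 2 / 2))) *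
        ENNReal.ofReal (Real.exp (-(t * levyExponent ν (s • ξ)))) := by
    intro t (ht : 0 < t)
    refine lintegral_gaussProfile_eq (a := fun ξ => t * levyExponent ν ξ) (by fun_prop)
      (fun ξ => mul_nonneg ht.le (levyExponent_nonneg ν ξ)) (fun ξ => ?_) s
    rw [hX.lawKernel_apply, hX.charFun_eq, Real.coe_toNNReal t ht.le]
  rw [setLIntegral_congr_fun measurableSet_Ioi e1, lintegral_lintegral_swap]
  · refine lintegral_congr fun ξ => ?_
    rw [lintegral_const_mul _ (by fun_prop),
      lintegral_exp_neg_mul_Ioi (levyExponent_nonneg ν (s • ξ))]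
  · exact Measurable.aemeasurable (by fun_prop)

end LevyPotential

/-! ### Polar coordinates and the constants -/

section Polar

variable {d : ℕ} [NeZero d]

/-- The surface area of the unit sphere of `ℝ^d`. -/
noncomputable def sphereArea (d : ℕ) : ℝ :=
  d * volume.real (Metric.ball (0 : EuclideanSpace ℝ (Fin d)) 1)

theorem sphereArea_pos (d : ℕ) [NeZero d] : 0 < sphereArea d := by
  have : 0 < d := NeZero.pos d
  have : 0 < volume.real (Metric.ball (0 : EuclideanSpace ℝ (Fin d)) 1) :=
    ENNReal.toReal_pos (Metric.measure_ball_pos volume _ one_pos).ne' measure_ball_lt_top.ne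
  unfold sphereArea
  positivity

theorem sphereArea_inv (d : ℕ) [NeZero d] :
    (sphereArea d)⁻¹ = Real.Gamma ((d : ℝ) / 2) / (2 * Real.pi ^ ((d : ℝ) / 2)) := by
  have hd : (0 : ℝ) < d := by exact_mod_cast NeZero.pos d
  have hG : 0 < Real.Gamma ((d : ℝ) / 2) := Real.Gamma_pos_of_pos (by positivity)
  have hpi : Real.sqrt Real.pi ^ d = Real.pi ^ ((d : ℝ) / 2) := by
    rw [Real.sqrt_eq_rpow, ← Real.rpow_natCast, ← Real.rpow_mul Real.pi_pos.le]
    congr 1; ring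
  unfold sphereArea
  rw [measureReal_def, EuclideanSpace.volume_ball, Fintype.card_fin, ENNReal.ofReal_one, one_pow,
    one_mul, hpi, Real.Gamma_add_one (by positivity), ENNReal.toReal_ofReal (by positivity)]
  field_simp

theorem integral_fun_norm_eq (f : ℝ → ℝ) :
    ∫ x : EuclideanSpace ℝ (Fin d), f ‖x‖ =
      sphereArea d * ∫ y in Set.Ioi 0, f y * y ^ (d - 1) := by
  rw [integral_fun_norm_addHaar, finrank_euclideanSpace_fin, sphereArea]
  simp only [nsmul_eq_mul, smul_eq_mul, mul_assoc, mul_comm (_ ^ (d - 1))]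

theorem integrable_fun_norm_iff {f : ℝ → ℝ} :
    Integrable (fun x : EuclideanSpace ℝ (Fin d) => f ‖x‖) ↔
      IntegrableOn (fun y => f y * y ^ (d - 1)) (Set.Ioi 0) := by
  rw [integrable_fun_norm_addHaar, finrank_euclideanSpace_fin]
  simp only [smul_eq_mul, mul_comm]

/-- The total mass of the standard Gaussian law in polar coordinates. -/
theorem gaussConst_mul_sphereArea_mul_integral (d : ℕ) [NeZero d] :
    gaussConst d * sphereArea d * ∫ r in Set.Ioi 0, gaussWeight d r = 1 := by
  have h1 := GaussianFourier.integral_rexp_neg_mul_sq_norm (V := EuclideanSpace ℝ (Fin d))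
    (b := 1 / 2) (by norm_num)
  rw [finrank_euclideanSpace_fin, integral_fun_norm_eq (fun r => Real.exp (-(1 / 2) * r ^ 2))] at h1
  have h2 : ∫ r in Set.Ioi 0, gaussWeight d r =
      ∫ y in Set.Ioi 0, Real.exp (-(1 / 2) * y ^ 2) * y ^ (d - 1) := by
    refine integral_congr_ae (.of_forall fun r => ?_)
    simp only [gaussWeight]
    rw [mul_comm]
    ring_nf
  rw [h2, mul_assoc, h1, gaussConst, show Real.pi / (1 / 2) = 2 * Real.pi by ring]
  exact inv_mul_cancel₀ (by positivity)

end Polar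

/-! ### The Gaussian identity for the radial profiles -/

section PotentialIdentity

variable {d : ℕ}

theorem integrable_gaussProfile_norm {s : ℝ} (hs : 0 < s) :
    Integrable fun x : EuclideanSpace ℝ (Fin d) => gaussProfile (s * ‖x‖) := by
  have := (integrable_exp_neg_sq_norm (d := d)).comp_smul hs.ne'
  refine this.congr (.of_forall fun x => ?_)
  simp only [gaussProfile, norm_smul, Real.norm_of_nonneg hs.le]

variable [NeZero d] {m : Measure (EuclideanSpace ℝ (Fin d))}
  {G : EuclideanSpace ℝ (Fin d) → ℝ≥0}

theorem IsUnimodalDensity.lintegral_eq (h : IsUnimodalDensity m G)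
    {f : EuclideanSpace ℝ (Fin d) → ℝ≥0∞} (hf : Measurable f) :
    ∫⁻ x, f x ∂m = f 0 * m {0} + ∫⁻ x, G x * f x := by
  have h0 : MeasurableSet ({0} : Set (EuclideanSpace ℝ (Fin d))) := measurableSet_singleton 0
  have hres : m.restrict {0}ᶜ = volume.withDensity (fun x => (G x : ℝ≥0∞)) := by
    ext A hA
    rw [Measure.restrict_apply hA, h.2 _ (hA.inter h0.compl) (by simp), withDensity_apply _ hA,
      ← Set.sdiff_eq]
    exact setLIntegral_congr (sdiff_null_ae_eq_self (measure_singleton 0))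
  rw [← lintegral_add_compl f h0, hres, lintegral_singleton,
    lintegral_withDensity_eq_lintegral_mul₀ h.aemeasurable.coe_nnreal_ennreal hf.aemeasurable]
  rfl

/-- In the unit ball the profile is at most `1` and `m` is finite; outside it `G` is bounded by its
value on the unit sphere and the Gaussian is integrable. -/
theorem IsUnimodalDensity.lintegral_gaussProfile_lt_top (h : IsUnimodalDensity m G)
    (hfin : ∀ r, m (Metric.closedBall 0 r) < ∞) {s : ℝ} (hs : 0 < s) :
    ∫⁻ x, G x * ENNReal.ofReal (gaussProfile (s * ‖x‖)) < ∞ := by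
  set B := Metric.closedBall (0 : EuclideanSpace ℝ (Fin d)) 1 with hB
  have hBm : MeasurableSet B := Metric.isClosed_closedBall.measurableSet
  rw [← lintegral_add_compl _ hBm, ENNReal.add_lt_top]
  constructor
  · have h1 : ∫⁻ x in B, G x * ENNReal.ofReal (gaussProfile (s * ‖x‖)) ≤
        ∫⁻ x in B \ {0}, G x := by
      rw [setLIntegral_congr (sdiff_null_ae_eq_self (measure_singleton 0))]
      refine setLIntegral_mono' hBm fun x _ => ?_
      refine mul_le_of_le_one_right' ?_
      rw [ENNReal.ofReal_le_one]
      exact gaussProfile_le_one _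
    rw [← h.2 _ (hBm.diff (measurableSet_singleton 0)) (by simp)] at h1
    exact h1.trans_lt ((measure_mono Set.sdiff_subset).trans_lt (hfin 1))
  · set e : EuclideanSpace ℝ (Fin d) := EuclideanSpace.single (0 : Fin d) 1 with he
    have h1 : ∫⁻ x in Bᶜ, G x * ENNReal.ofReal (gaussProfile (s * ‖x‖)) ≤
        ∫⁻ x : EuclideanSpace ℝ (Fin d), G e * ENNReal.ofReal (gaussProfile (s * ‖x‖)) := by
      refine (setLIntegral_mono' hBm.compl fun x hx => ?_).trans (setLIntegral_le_lintegral _ _)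
      have hx1 : 1 < ‖x‖ := by simpa [hB] using hx
      gcongr
      exact h.1 e x (by simp [he]) (by simpa [he] using hx1.le)
    refine h1.trans_lt ?_
    rw [lintegral_const_mul' _ _ ENNReal.coe_ne_top]
    exact ENNReal.mul_lt_top ENNReal.coe_lt_top (integrable_gaussProfile_norm hs).lintegral_lt_top

/-- Finiteness of `m` on balls makes the left side of `hid` finite, hence also the right side. This
supplies the integrability of `1/ψ` against the Gaussian and allows passage to real integrals. -/
theorem IsUnimodalDensity.gaussianPotentialIdentity (h : IsUnimodalDensity m G)
    (hfin : ∀ r, m (Metric.closedBall 0 r) < ∞) {ψ : EuclideanSpace ℝ (Fin d) → ℝ}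
    (hψc : Continuous ψ) (hψ0 : ∀ ξ, 0 ≤ ψ ξ) (hψr : ∀ ξ η, ‖ξ‖ = ‖η‖ → ψ ξ = ψ η)
    (hid : ∀ s : ℝ, ∫⁻ x, ENNReal.ofReal (gaussProfile (s * ‖x‖)) ∂m =
      ∫⁻ ξ, ENNReal.ofReal (gaussConst d * Real.exp (-(‖ξ‖ ^ 2 / 2))) *
        (ENNReal.ofReal (ψ (s • ξ)))⁻¹) :
    GaussianPotentialIdentity d (fun r => G (EuclideanSpace.single (0 : Fin d) r))
      (radialProfile ψ) (m.real {0}) (sphereArea d) (gaussConst d * sphereArea d) := by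
  set φ : ℝ → ℝ := fun r => G (EuclideanSpace.single (0 : Fin d) r) with hφ
  have hc0 := gaussConst_pos d
  have hgc := continuous_gaussProfile
  have hGφ : ∀ᵐ x : EuclideanSpace ℝ (Fin d), (G x : ℝ) = φ ‖x‖ := by
    filter_upwards [Measure.ae_ne volume 0] with x hx
    rw [hφ, h.eq_single_norm hx]
  have hψφ : ∀ (s : ℝ), 0 < s → ∀ ξ : EuclideanSpace ℝ (Fin d),
      ψ (s • ξ) = radialProfile ψ (‖ξ‖ * s) := fun s hs ξ => by
    refine hψr _ _ ?_
    rw [norm_single_zero, norm_smul, Real.norm_of_nonneg hs.le, mul_comm,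
      abs_of_nonneg (by positivity)]
  -- the two sides as functions of the norm
  let F : ℝ → ℝ → ℝ := fun s r => gaussProfile (s * r) * φ r
  let H : ℝ → ℝ → ℝ := fun s r =>
    gaussConst d * Real.exp (-(r ^ 2 / 2)) * (radialProfile ψ (r * s))⁻¹
  have hFae : ∀ s, (fun x : EuclideanSpace ℝ (Fin d) => gaussProfile (s * ‖x‖) * (G x : ℝ))
      =ᵐ[volume] fun x => F s ‖x‖ := fun s => by
    filter_upwards [hGφ] with x hx
    simp only [F, hx]
  have hFlint : ∀ s, ∫⁻ x, G x * ENNReal.ofReal (gaussProfile (s * ‖x‖)) =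
      ∫⁻ x : EuclideanSpace ℝ (Fin d), ENNReal.ofReal (F s ‖x‖) := fun s => by
    refine lintegral_congr_ae ?_
    filter_upwards [hFae s] with x hx
    rw [← hx, ENNReal.ofReal_mul (gaussProfile_pos _).le, ENNReal.ofReal_coe_nnreal, mul_comm]
  have hF0 : ∀ s r, 0 ≤ F s r := fun s r => mul_nonneg (gaussProfile_pos _).le (NNReal.coe_nonneg _)
  have hFint : ∀ s, 0 < s → Integrable fun x : EuclideanSpace ℝ (Fin d) => F s ‖x‖ := by
    intro s hs
    have hm : AEStronglyMeasurable (fun x : EuclideanSpace ℝ (Fin d) => F s ‖x‖) := by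
      refine AEMeasurable.aestronglyMeasurable (AEMeasurable.congr ?_ (hFae s))
      exact (Measurable.aemeasurable (by fun_prop)).mul h.aemeasurable.coe_nnreal_real
    refine ⟨hm, ?_⟩
    rw [hasFiniteIntegral_iff_ofReal (.of_forall fun x => hF0 _ _), ← hFlint]
    exact h.lintegral_gaussProfile_lt_top hfin hs
  have hH0 : ∀ s r, 0 ≤ H s r := fun s r =>
    mul_nonneg (by positivity) (inv_nonneg.2 (hψ0 _))
  have hm0 : m {0} ≠ ∞ := ((measure_mono (t := Metric.closedBall 0 0) (by simp)).trans_lt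
    (hfin 0)).ne
  have hL : ∀ s, ∫⁻ x, ENNReal.ofReal (gaussProfile (s * ‖x‖)) ∂m =
      m {0} + ∫⁻ x : EuclideanSpace ℝ (Fin d), ENNReal.ofReal (F s ‖x‖) := fun s => by
    rw [h.lintegral_eq (by fun_prop), hFlint]
    simp [gaussProfile]
  have hLfin : ∀ s, 0 < s → ∫⁻ x, ENNReal.ofReal (gaussProfile (s * ‖x‖)) ∂m < ∞ := fun s hs => by
    rw [hL, ← hFlint]
    exact ENNReal.add_lt_top.2 ⟨hm0.lt_top, h.lintegral_gaussProfile_lt_top hfin hs⟩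
  -- The inverse in `ℝ≥0∞` and the real inverse disagree at zeros of `ψ`. Finiteness of the integral
  -- makes these zeros negligible.
  have hRlint : ∀ s, 0 < s → ∫⁻ x, ENNReal.ofReal (gaussProfile (s * ‖x‖)) ∂m =
      ∫⁻ ξ : EuclideanSpace ℝ (Fin d), ENNReal.ofReal (H s ‖ξ‖) := fun s hs => by
    have hlt := hLfin s hs
    rw [hid] at hlt ⊢
    have hae := ae_lt_top (by fun_prop) hlt.ne
    refine lintegral_congr_ae ?_
    filter_upwards [hae] with ξ hξ
    have hψpos : 0 < ψ (s • ξ) := by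
      refine (hψ0 _).lt_of_ne fun h0 => hξ.ne ?_
      rw [← h0, ENNReal.ofReal_zero, ENNReal.inv_zero, ENNReal.mul_top]
      exact (ENNReal.ofReal_pos.2 (by positivity)).ne'
    simp only [H]
    rw [← hψφ s hs, ← ENNReal.ofReal_inv_of_pos hψpos, ← ENNReal.ofReal_mul (by positivity)]
  have hHint : ∀ s, 0 < s → Integrable fun ξ : EuclideanSpace ℝ (Fin d) => H s ‖ξ‖ := by
    intro s hs
    refine ⟨?_, ?_⟩
    · simp only [H, ← hψφ s hs]
      exact Measurable.aestronglyMeasurable (by fun_prop)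
    · rw [hasFiniteIntegral_iff_ofReal (.of_forall fun x => hH0 _ _), ← hRlint s hs]
      exact hLfin s hs
  have hHeq : ∀ s r, H s r * r ^ (d - 1) =
      gaussConst d * ((radialProfile ψ (r * s))⁻¹ * gaussWeight d r) := fun s r => by
    simp only [H, gaussWeight]; ring
  refine ⟨fun x hx y hy hxy => ?_, fun y _ => NNReal.coe_nonneg _, sphereArea_pos d,
    gaussConst_mul_sphereArea_mul_integral d, fun s hs => integrable_fun_norm_iff.1 (hFint s hs),
    fun s hs => ?_, fun s hs => ?_⟩
  · have hx0 : (0 : ℝ) < x := hx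
    have hy0 : (0 : ℝ) < y := hy
    refine NNReal.coe_le_coe.2 (h.1 _ _ (by simpa using hx0.ne') ?_)
    simpa [abs_of_pos hx0, abs_of_pos hy0] using hxy
  · have h1 := integrable_fun_norm_iff.1 (hHint s hs)
    simp_rw [hHeq] at h1
    refine (h1.const_mul (gaussConst d)⁻¹).congr (.of_forall fun r => ?_)
    simp only
    rw [inv_mul_cancel_left₀ hc0.ne']
  · have h1 := integral_fun_norm_eq (d := d) (F s)
    have h2 := integral_fun_norm_eq (d := d) (H s)
    simp_rw [hHeq] at h2
    rw [integral_const_mul] at h2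
    have h3 := congrArg ENNReal.toReal ((hL s).symm.trans (hRlint s hs))
    rw [ENNReal.toReal_add hm0 (hFint s hs).lintegral_lt_top.ne,
      ← integral_eq_lintegral_of_nonneg_ae (.of_forall fun x => hF0 _ _)
        (hFint s hs).aestronglyMeasurable,
      ← integral_eq_lintegral_of_nonneg_ae (.of_forall fun x => hH0 _ _)
        (hHint s hs).aestronglyMeasurable, h1, h2] at h3
    rw [measureReal_def, h3]
    ring

end PotentialIdentity

/-! ### Asymptotics of the potential density -/

theorem corollary3p11 {d : ℕ} [NeZero d] {Ω : Type*} [MeasurableSpace Ω]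
    (P : Measure Ω) [IsProbabilityMeasure P]
    (X : ℝ≥0 → Ω → EuclideanSpace ℝ (Fin d)) (ν : Measure (EuclideanSpace ℝ (Fin d)))
    (hX : IsIsotropicUnimodalLevyProcess X P ν) (htrans : IsTransient X P) :
    (∃ G : EuclideanSpace ℝ (Fin d) → ℝ≥0, IsUnimodalDensity (potentialMeasure X P) G) ∧
    ∀ G : EuclideanSpace ℝ (Fin d) → ℝ≥0, IsUnimodalDensity (potentialMeasure X P) G →
      (∀ l : ℝ → ℝ, SlowlyVaryingAtInfty l →
        radialProfile (levyExponent ν) ∈ deHaanAtInfty l →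
        Tendsto
          (fun x : EuclideanSpace ℝ (Fin d) => (G x : ℝ) /
            ((‖x‖ ^ d)⁻¹ * (radialProfile (levyExponent ν) ‖x‖⁻¹ ^ 2)⁻¹ * l ‖x‖⁻¹))
          (𝓝[≠] 0)
          (𝓝 (Real.Gamma ((d : ℝ) / 2) / (2 * Real.pi ^ ((d : ℝ) / 2))))) ∧
      (∀ l : ℝ → ℝ, SlowlyVaryingAtZero l →
        radialProfile (levyExponent ν) ∈ deHaanAtZero l →
        Tendsto
          (fun x : EuclideanSpace ℝ (Fin d) => (G x : ℝ) /
            ((‖x‖ ^ d)⁻¹ * (radialProfile (levyExponent ν) ‖x‖⁻¹ ^ 2)⁻¹ * l ‖x‖⁻¹))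
          (Bornology.cobounded (EuclideanSpace ℝ (Fin d)))
          (𝓝 (Real.Gamma ((d : ℝ) / 2) / (2 * Real.pi ^ ((d : ℝ) / 2))))) := by
  refine ⟨hX.exists_isUnimodalDensity htrans, fun G hG => ?_⟩
  have hd : 0 < d := NeZero.pos d
  have hGm := hX.isUnimodalDensity_potential_iff.2 hG
  have hψc := hX.continuous_levyExponent
  have key := hGm.gaussianPotentialIdentity (hX.potential_closedBall_lt_top htrans) hψc
    (levyExponent_nonneg ν) (fun ξ η => hX.levyExponent_eq_of_norm_eq)
    hX.lintegral_gaussProfile_potential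
  have hψp : Continuous (radialProfile (levyExponent ν) : ℝ → ℝ) :=
    hψc.comp (Isometry.of_dist_eq fun a b => PiLp.dist_single_same 2 (fun _ => ℝ) 0 a b).continuous
  -- The profile asymptotics are used at `s = ‖x‖⁻¹`. The origin is excluded because the value of
  -- `G` there is arbitrary.
  have hcongr : ∀ (l : ℝ → ℝ) (x : EuclideanSpace ℝ (Fin d)), x ≠ 0 →
      (G (EuclideanSpace.single (0 : Fin d) (‖x‖⁻¹)⁻¹) : ℝ) /
        ((‖x‖⁻¹) ^ d * (radialProfile (levyExponent ν) ‖x‖⁻¹ ^ 2)⁻¹ * l ‖x‖⁻¹) =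
      (G x : ℝ) / ((‖x‖ ^ d)⁻¹ * (radialProfile (levyExponent ν) ‖x‖⁻¹ ^ 2)⁻¹ * l ‖x‖⁻¹) :=
    fun l x hx => by rw [inv_inv, ← hG.eq_single_norm hx, inv_pow]
  rw [← sphereArea_inv]
  refine ⟨fun l hl hψ => ?_, fun l hl hψ => ?_⟩
  · have h1 := (key.tendsto_atTop hd hψp hl hψ).comp
      (tendsto_inv_nhdsGT_zero.comp (tendsto_norm_nhdsNE_zero (E := EuclideanSpace ℝ (Fin d))))
    refine h1.congr' ?_
    filter_upwards [self_mem_nhdsWithin] with x hx using hcongr l x hx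
  · have h1 := (key.tendsto_nhdsGT_zero hd hψp hl hψ).comp
      (tendsto_inv_atTop_nhdsGT_zero.comp
        (tendsto_norm_cobounded_atTop (E := EuclideanSpace ℝ (Fin d))))
    refine h1.congr' ?_
    filter_upwards [Bornology.eventually_ne_cobounded (0 : EuclideanSpace ℝ (Fin d))] with x hx
      using hcongr l x hx
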